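/- Let $p$ be a prime, let $E^0$ be a commutative, complete, Noetherian, $p$-local local ring with maximal ideal $\mathfrak m$, and let $F$ be a commutative one-dimensional formal group law over $E^0$ whose reduction modulo $\mathfrak m$ has finite height $n$, i.e. the reduction of $[p]_F(x)$ has leading term a unit multiple of $x^{p^n}$. (For example, $E^0$ and $F$ may be the coefficient ring in degree $0$ and the formal group law of a $K(n)$-local admissible even periodic cohomology theory $E$, so that $\mathbb G=\mathrm{spf}(E^0\mathbb CP^\infty)$.) Let $\mathbb G$ be the formal group over $X=\mathrm{spf}(E^0)$ with coordinate $x$ and group law $F$. A discrete $E^0$-algebra is a commutative $E^0$-algebra $A$ with $\mathfrak m^kA=0$ for some $k$; for such $A$, $\mathbb G(A)$ is the set of nilpotent elements of $A$, with addition given by $F$. Let $\mathrm{Div}^+(\mathbb G)=\coprod_{d\ge 0}\mathbb G^d/\Sigma_d$ be the formal scheme of effective divisors on $\mathbb G$. Thus a point of $\mathrm{Div}^+_d(\mathbb G)=\mathbb G^d/\Sigma_d$ over $A$ is a monic polynomial of degree $d$ over $A$ whose lower coefficients are nilpotent, $[a]$ is the divisor with equation $t-x(a)$, and divisors are added by multiplying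 equations. It is a $\Lambda$-semiring scheme, with multiplication and operations $\lambda^r$ determined by naturality and $$\Big(\sum_i[a_i]\Big)\Big(\sum_j[b_j]\Big)=\sum_{i,j}[a_i+b_j],\qquad \lambda^r\Big(\sum_{i=1}^d[a_i]\Big)=\sum_{i_1<\dots<i_r}[a_{i_1}+\dots+a_{i_r}].$$ For a finite group $G$, let $R^+(G)$ be the $\Lambda$-semiring of isomorphism classes of finite-dimensional complex representations of $G$, under direct sum, tensor product and exterior powers. Let $X_{\mathrm{Ch}}(G)$ be the functor sending a discrete $E^0$-algebra $A$ to the set of $\Lambda$-semiring homomorphisms $R^+(G)\to\mathrm{Div}^+(\mathbb G)(A)$, and let $C(E,G)$ be the ring of natural transformations from $X_{\mathrm{Ch}}(G)$ to the forgetful functor $A\mapsto A$. Then, for every finite group $G$, the scheme $X_{\mathrm{Ch}}(G)$ is finite over $X=\mathrm{spf}(E^0)$. That is, $C(E,G)$ is a finitely generated $E^0$-module, and for every discrete $E^0$-algebra $A$ the evaluation map $X_{\mathrm{Ch}}(G)(A)\to\mathrm{Hom}_{E^0\text{-alg}}(C(E,G),A)$ is bijective, so that $X_{\mathrm{Ch}}(G)=\mathrm{spf}(C(E,G))$.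 -/

import Mathlib

open CategoryTheory
open scoped Polynomial

universe u v

noncomputable section

/-! ### The semiring `R⁺(G)` of isomorphism classes of complex representations -/

namespace ChernApprox

section Representations

variable {G : Type v} [Group G]

/-- Two finite dimensional representations related by an equivariant linear equivalence are
isomorphic. -/
theorem isIsomorphic_of_equivariant {V W : FDRep ℂ G} (e : V ≃ₗ[ℂ] W)
    (h : ∀ g, e.toLinearMap ∘ₗ V.ρ g = W.ρ g ∘ₗ e.toLinearMap) : IsIsomorphic V W :=
  ⟨Action.mkIso (LinearEquiv.toFGModuleCatIso e) fun g => by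
    ext x
    exact LinearMap.congr_fun (h g) x⟩

/-- Isomorphic finite dimensional representations are related by an equivariant linear
equivalence. -/
theorem exists_equivariant {V W : FDRep ℂ G} (h : IsIsomorphic V W) :
    ∃ e : V ≃ₗ[ℂ] W, ∀ g, e.toLinearMap ∘ₗ V.ρ g = W.ρ g ∘ₗ e.toLinearMap := by
  obtain ⟨i⟩ := h
  refine ⟨FDRep.isoToLinearEquiv i, fun g => ?_⟩
  rw [FDRep.Iso.conj_ρ i g]
  ext x
  simp [LinearEquiv.conj_apply]

/-- The `k`-th exterior power of a representation. -/
def extPow {V : Type} [AddCommGroup V] [Module ℂ V] (k : ℕ) (ρ : Representation ℂ G V) :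
    Representation ℂ G (⋀[ℂ]^k V) where
  toFun g := exteriorPower.map k (ρ g)
  map_one' := by
    rw [map_one]
    exact exteriorPower.map_id
  map_mul' g h := by
    rw [map_mul]
    exact exteriorPower.map_comp (ρ h) (ρ g)

variable (G) in
/-- `R⁺(G)`: the isomorphism classes of finite dimensional complex representations of `G`. -/
def RepPlus : Type _ := Quotient (isIsomorphicSetoid (FDRep.{0} ℂ G))

namespace RepPlus

/-- The isomorphism class of a representation. -/
def mk (V : FDRep.{0} ℂ G) : RepPlus G := Quotient.mk (isIsomorphicSetoid (FDRep.{0} ℂ G)) V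

/-- The zero representation. -/
instance : Zero (RepPlus G) := ⟨mk (FDRep.of (Representation.trivial ℂ G PUnit.{1}))⟩

/-- The trivial representation of rank one. -/
instance : One (RepPlus G) := ⟨mk (FDRep.of (Representation.trivial ℂ G ℂ))⟩

/-- Addition is direct sum. -/
instance : Add (RepPlus G) :=
  ⟨Quotient.map₂ (fun V W => FDRep.of (Representation.prod V.ρ W.ρ)) fun _ _ h _ _ h' => by
    obtain ⟨e, he⟩ := exists_equivariant h
    obtain ⟨e', he'⟩ := exists_equivariant h'
    refine isIsomorphic_of_equivariant (LinearEquiv.prodCongr e e') fun g => ?_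
    refine LinearMap.ext fun x => Prod.ext ?_ ?_
    · exact LinearMap.congr_fun (he g) x.1
    · exact LinearMap.congr_fun (he' g) x.2⟩

/-- Multiplication is tensor product. -/
instance : Mul (RepPlus G) :=
  ⟨Quotient.map₂ (fun V W => FDRep.of (Representation.tprod V.ρ W.ρ)) fun _ _ h _ _ h' => by
    obtain ⟨e, he⟩ := exists_equivariant h
    obtain ⟨e', he'⟩ := exists_equivariant h'
    refine isIsomorphic_of_equivariant (TensorProduct.congr e e') fun g => ?_
    refine TensorProduct.ext' fun x y => ?_
    exact congrArg₂ (fun a b => a ⊗ₜ[ℂ] b) (LinearMap.congr_fun (he g) x)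
      (LinearMap.congr_fun (he' g) y)⟩

/-- The operation `λᵏ` is given by the `k`-th exterior power. -/
def lam (k : ℕ) : RepPlus G → RepPlus G :=
  Quotient.map (fun V => FDRep.of (extPow k V.ρ)) fun _ _ h => by
    obtain ⟨e, he⟩ := exists_equivariant h
    have h₁ : exteriorPower.map k e.symm.toLinearMap ∘ₗ exteriorPower.map k e.toLinearMap
        = LinearMap.id := by
      rw [← exteriorPower.map_comp, ← exteriorPower.map_id]; congr 1; ext; simp
    have h₂ : exteriorPower.map k e.toLinearMap ∘ₗ exteriorPower.map k e.symm.toLinearMap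
        = LinearMap.id := by
      rw [← exteriorPower.map_comp, ← exteriorPower.map_id]; congr 1; ext; simp
    refine isIsomorphic_of_equivariant (LinearEquiv.ofLinearMap _ _ h₂ h₁) fun g => ?_
    exact (exteriorPower.map_comp _ _).symm.trans
      ((congrArg (exteriorPower.map k) (he g)).trans (exteriorPower.map_comp _ _))

end RepPlus

end Representations

/-! ### Effective divisors -/

section Divisors

variable {A B : Type u} [CommRing A] [CommRing B]

/-- `f = t ^ d + c₁ t ^ (d - 1) + ⋯ + c_d` with all `cᵢ` nilpotent; such polynomials are the
`A`-points of `Div_d⁺ = Spf 𝒪⟦c₁, …, c_d⟧`. The zero ring is allowed, where this always holds. -/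
structure IsDivisorOfDegree (d : ℕ) (f : A[X]) : Prop where
  coeff_eq_one : f.coeff d = 1
  coeff_eq_zero : ∀ i, d < i → f.coeff i = 0
  isNilpotent_coeff : ∀ i, i < d → IsNilpotent (f.coeff i)

/-- `f` is the equation of an `A`-point of `Div⁺ = ∐_d Div_d⁺`: there is a splitting
`A = A₁ × ⋯ × A_N`, given by a complete system of orthogonal idempotents `eᵢ`, such that the image
of `f` over `Aᵢ` is the equation of a divisor of some degree `dᵢ`. -/
def IsDivisor (f : A[X]) : Prop :=
  ∃ (N : ℕ) (e : Fin N → A) (d : Fin N → ℕ), CompleteOrthogonalIdempotents e ∧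
    ∀ i, ∃ g : A[X], IsDivisorOfDegree (d i) g ∧ Polynomial.C (e i) * f = Polynomial.C (e i) * g

theorem IsDivisorOfDegree.map {d : ℕ} {f : A[X]} (hf : IsDivisorOfDegree d f) (φ : A →+* B) :
    IsDivisorOfDegree d (f.map φ) where
  coeff_eq_one := by rw [Polynomial.coeff_map, hf.coeff_eq_one, map_one]
  coeff_eq_zero i hi := by rw [Polynomial.coeff_map, hf.coeff_eq_zero i hi, map_zero]
  isNilpotent_coeff i hi := by
    rw [Polynomial.coeff_map]
    exact (hf.isNilpotent_coeff i hi).map φ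

theorem isDivisorOfDegree_iff {d : ℕ} {f : A[X]} :
    IsDivisorOfDegree d f ↔ f.coeff d = 1 ∧ f.natDegree ≤ d ∧
      f.map (Ideal.Quotient.mk (nilradical A)) = Polynomial.X ^ d := by
  constructor
  · intro h
    refine ⟨h.1, Polynomial.natDegree_le_iff_coeff_eq_zero.2 h.2, ?_⟩
    ext i
    rw [Polynomial.coeff_map, Polynomial.coeff_X_pow]
    rcases lt_trichotomy i d with hi | rfl | hi
    · rw [if_neg hi.ne, Ideal.Quotient.eq_zero_iff_mem]
      exact h.3 i hi
    · simp [h.1]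
    · rw [if_neg hi.ne', h.2 i hi, map_zero]
  · rintro ⟨h₁, h₂, h₃⟩
    refine ⟨h₁, Polynomial.natDegree_le_iff_coeff_eq_zero.1 h₂, fun i hi => ?_⟩
    have := congrArg (fun q => q.coeff i) h₃
    simp only [Polynomial.coeff_map, Polynomial.coeff_X_pow, if_neg hi.ne,
      Ideal.Quotient.eq_zero_iff_mem] at this
    exact this

theorem IsDivisorOfDegree.mul {d e : ℕ} {f g : A[X]} (hf : IsDivisorOfDegree d f)
    (hg : IsDivisorOfDegree e g) : IsDivisorOfDegree (d + e) (f * g) := by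
  rw [isDivisorOfDegree_iff] at hf hg ⊢
  obtain ⟨hf₁, hf₂, hf₃⟩ := hf
  obtain ⟨hg₁, hg₂, hg₃⟩ := hg
  refine ⟨?_, Polynomial.natDegree_mul_le_of_le hf₂ hg₂, ?_⟩
  · rw [Polynomial.coeff_mul_add_eq_of_natDegree_le hf₂ hg₂, hf₁, hg₁, one_mul]
  · rw [Polynomial.map_mul, hf₃, hg₃, pow_add]

theorem isDivisorOfDegree_one : IsDivisorOfDegree 0 (1 : A[X]) :=
  isDivisorOfDegree_iff.2 (by simp)

theorem isDivisorOfDegree_X_sub_C {a : A} (ha : IsNilpotent a) :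
    IsDivisorOfDegree 1 (Polynomial.X - Polynomial.C a) := by
  refine isDivisorOfDegree_iff.2 ⟨by simp, Polynomial.natDegree_X_sub_C_le a, ?_⟩
  have : Ideal.Quotient.mk (nilradical A) a = 0 := Ideal.Quotient.eq_zero_iff_mem.2 ha
  simp [this]

theorem IsDivisorOfDegree.isDivisor {d : ℕ} {f : A[X]} (hf : IsDivisorOfDegree d f) :
    IsDivisor f :=
  ⟨1, fun _ => 1, fun _ => d,
    ⟨⟨fun _ => IsIdempotentElem.one, fun i j h => (h (Subsingleton.elim i j)).elim⟩, by simp⟩,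
    fun _ => ⟨f, hf, rfl⟩⟩

theorem IsDivisor.mul {f g : A[X]} (hf : IsDivisor f) (hg : IsDivisor g) : IsDivisor (f * g) := by
  obtain ⟨N, e, d, he, h⟩ := hf
  obtain ⟨M, e', d', he', h'⟩ := hg
  let σ := (finProdFinEquiv (m := N) (n := M)).symm
  refine ⟨N * M, fun k => e (σ k).1 * e' (σ k).2, fun k => d (σ k).1 + d' (σ k).2,
    ⟨⟨fun k => (he.idem _).mul (he'.idem _), fun k l hkl => ?_⟩, ?_⟩, fun k => ?_⟩
  · show e (σ k).1 * e' (σ k).2 * (e (σ l).1 * e' (σ l).2) = 0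
    by_cases h₁ : (σ k).1 = (σ l).1
    · have h₂ : (σ k).2 ≠ (σ l).2 := fun h₂ => hkl (σ.injective (Prod.ext h₁ h₂))
      rw [mul_mul_mul_comm, he'.ortho h₂, mul_zero]
    · rw [mul_mul_mul_comm, he.ortho h₁, zero_mul]
  · rw [Equiv.sum_comp σ (fun x : Fin N × Fin M => e x.1 * e' x.2), Fintype.sum_prod_type,
      ← Finset.sum_mul_sum, he.complete, he'.complete, one_mul]
  · obtain ⟨g₁, hg₁, h₁⟩ := h (σ k).1
    obtain ⟨g₂, hg₂, h₂⟩ := h' (σ k).2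
    refine ⟨g₁ * g₂, hg₁.mul hg₂, ?_⟩
    rw [Polynomial.C_mul, mul_mul_mul_comm, h₁, h₂, mul_mul_mul_comm]

theorem IsDivisor.map {f : A[X]} (hf : IsDivisor f) (φ : A →+* B) : IsDivisor (f.map φ) := by
  obtain ⟨N, e, d, he, h⟩ := hf
  refine ⟨N, φ ∘ e, d, he.map φ, fun i => ?_⟩
  obtain ⟨g, hg, hfg⟩ := h i
  refine ⟨g.map φ, hg.map φ, ?_⟩
  have := congrArg (Polynomial.map φ) hfg
  simpa using this

variable (A) in
/-- The equations of effective divisors over `A`, as a multiplicative monoid. -/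
def divisorEquations : Submonoid A[X] where
  carrier := {f | IsDivisor f}
  one_mem' := isDivisorOfDegree_one.isDivisor
  mul_mem' := IsDivisor.mul

variable (A) in
/-- The commutative monoid `Div⁺(𝔾)(A)` of effective divisors (of locally constant degree) on `𝔾`
over `A`. A divisor is given by its equation, and adding divisors is multiplying equations. -/
abbrev DivPlus : Type u := Additive (divisorEquations A)

/-- The functoriality of `Div⁺(𝔾)`. -/
def DivPlus.map (φ : A →+* B) : DivPlus A →+ DivPlus B where
  toFun D := Additive.ofMul ⟨D.toMul.1.map φ, D.toMul.2.map φ⟩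
  map_zero' := by
    apply Additive.toMul.injective
    exact Subtype.ext (Polynomial.map_one φ)
  map_add' D D' := by
    apply Additive.toMul.injective
    exact Subtype.ext (Polynomial.map_mul φ)

theorem DivPlus.map_map {C : Type u} [CommRing C] (φ : A →+* B) (ψ : B →+* C) (D : DivPlus A) :
    DivPlus.map ψ (DivPlus.map φ D) = DivPlus.map (ψ.comp φ) D := by
  apply Additive.toMul.injective
  exact Subtype.ext (Polynomial.map_map φ ψ _)

end Divisors

/-! ### The formal group and the `Λ`-semiring structure on `Div⁺(𝔾)` -/

section FormalGroups

variable {R : Type u} [CommRing R]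

instance isComm_map {S : Type u} [CommRing S] (F : FormalGroup R) [F.IsComm] (φ : R →+* S) :
    (F.map φ).IsComm where
  comm := by
    have h := congrArg (MvPowerSeries.map φ) (FormalGroup.IsComm.comm (F := F))
    have hX : MvPowerSeries.HasSubst (![MvPowerSeries.X 1, MvPowerSeries.X 0] :
        Fin 2 → MvPowerSeries (Fin 2) R) :=
      MvPowerSeries.hasSubst_of_constantCoeff_nilpotent fun s => by fin_cases s <;> simp
    rw [MvPowerSeries.map_subst hX] at h
    refine h.trans ?_
    congr 1
    funext i
    fin_cases i <;> simp

/-- The commutative monoid (in fact group) `𝔾(A)` for the formal group `𝔾` with group law `F`.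
A power series in no variables is a constant, so the elements are the nilpotent elements of `A`,
added with `F`. -/
abbrev GPoint (F : FormalGroup R) (A : Type u) [CommRing A] [Algebra R A] : Type u :=
  (F.map (algebraMap R A)).Point PEmpty.{1}

/-- The coordinate `x : 𝔾(A) → Nil(A)`. -/
def GPoint.coord {F : FormalGroup R} {A : Type u} [CommRing A] [Algebra R A] (a : GPoint F A) : A :=
  MvPowerSeries.constantCoeff a.1

/-- The divisor `[a]` of degree one, with equation `t - x(a)`. -/
def GPoint.div {F : FormalGroup R} {A : Type u} [CommRing A] [Algebra R A] (a : GPoint F A) :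
    DivPlus A :=
  Additive.ofMul ⟨Polynomial.X - Polynomial.C a.coord,
    (isDivisorOfDegree_X_sub_C a.2).isDivisor⟩

variable (F : FormalGroup R) [F.IsComm] {A : Type u} [CommRing A] [Algebra R A]

/-- `P` is the product `D * D'` in `Div⁺(𝔾)(A)`. The product is the unique natural operation with
`(∑ᵢ [aᵢ]) * (∑ⱼ [bⱼ]) = ∑ᵢ ∑ⱼ [aᵢ + bⱼ]`; it is pinned down by this rule because any two divisors
become sums of points over some jointly faithful family of `A`-algebras `B`. -/
def DivPlus.IsMul (D D' P : DivPlus A) : Prop :=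
  ∀ (B : Type u) [CommRing B] [Algebra R B] (φ : A →ₐ[R] B) (d e : ℕ)
    (a : Fin d → GPoint F B) (b : Fin e → GPoint F B),
    DivPlus.map φ.toRingHom D = ∑ i, (a i).div → DivPlus.map φ.toRingHom D' = ∑ j, (b j).div →
      DivPlus.map φ.toRingHom P = ∑ i, ∑ j, (a i + b j).div

/-- `P` is `λʳ(D)` in `Div⁺(𝔾)(A)`. The operation `λʳ` is the unique natural operation with
`λʳ(∑ᵢ [aᵢ]) = ∑_I [∑_{i ∈ I} aᵢ]`, where `I` runs over the `r`-element sets of indices. -/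
def DivPlus.IsLam (r : ℕ) (D P : DivPlus A) : Prop :=
  ∀ (B : Type u) [CommRing B] [Algebra R B] (φ : A →ₐ[R] B) (d : ℕ) (a : Fin d → GPoint F B),
    DivPlus.map φ.toRingHom D = ∑ i, (a i).div →
      DivPlus.map φ.toRingHom P =
        ∑ I ∈ Finset.powersetCard r (Finset.univ : Finset (Fin d)), (∑ i ∈ I, a i).div

/-! ### The Chern approximation -/

variable (G : Type v) [Group G]

variable (A) in
/-- `X_Ch(G)(A)`: the homomorphisms `R⁺(G) → Div⁺(𝔾)(A)` of `Λ`-semirings, i.e. the maps that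
preserve `0`, `1 = [0]`, `+`, `×` and all the operations `λʳ`. -/
@[ext]
structure XCh where
  toFun : RepPlus G → DivPlus A
  map_zero : toFun 0 = 0
  map_one : toFun 1 = (0 : GPoint F A).div
  map_add : ∀ V W, toFun (V + W) = toFun V + toFun W
  map_mul : ∀ V W, DivPlus.IsMul F (toFun V) (toFun W) (toFun (V * W))
  map_lam : ∀ r V, DivPlus.IsLam F r (toFun V) (toFun (RepPlus.lam r V))

/-- The functoriality of `X_Ch(G)`. -/
def XCh.map {F : FormalGroup R} [F.IsComm] {G : Type v} [Group G] {A' : Type u} [CommRing A']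
    [Algebra R A'] (φ : A →ₐ[R] A') (f : XCh F A G) : XCh F A' G where
  toFun V := DivPlus.map φ.toRingHom (f.toFun V)
  map_zero := by rw [f.map_zero, _root_.map_zero]
  map_one := by
    rw [f.map_one]
    apply Additive.toMul.injective
    apply Subtype.ext
    simp [DivPlus.map, GPoint.div, GPoint.coord]
  map_add V W := by rw [f.map_add, _root_.map_add]
  map_mul V W B _ _ ψ d e a b ha hb := by
    rw [DivPlus.map_map] at ha hb ⊢
    exact f.map_mul V W B (ψ.comp φ) d e a b ha hb
  map_lam r V B _ _ ψ d a ha := by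
    rw [DivPlus.map_map] at ha ⊢
    exact f.map_lam r V B (ψ.comp φ) d a ha

variable (R) in
/-- Discrete `R`-algebras, for the `𝔪`-adic topology on the local ring `R`: the structure map
kills a power of the maximal ideal. -/
abbrev DiscreteAlg [IsLocalRing R] : Type (u + 1) :=
  {A : CommAlgCat.{u} R //
    ∃ k : ℕ, IsLocalRing.maximalIdeal R ^ k ≤ RingHom.ker (algebraMap R A)}

/-- The ring `C(E, G) = 𝒪_{X_Ch(G)}` of natural transformations from the functor `X_Ch(G)` on
discrete `R`-algebras to the forgetful functor `𝔸¹`, as an `R`-algebra. -/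
def chernRing [IsLocalRing R] : Subalgebra R (∀ A : DiscreteAlg R, XCh F A.1 G → A.1) where
  carrier := {s | ∀ (A A' : DiscreteAlg R) (φ : A.1 →ₐ[R] A'.1) (f : XCh F A.1 G),
    s A' (f.map φ) = φ (s A f)}
  mul_mem' hs ht A A' φ f := by
    simp only [Pi.mul_apply, _root_.map_mul, hs A A' φ f, ht A A' φ f]
  add_mem' hs ht A A' φ f := by
    simp only [Pi.add_apply, _root_.map_add, hs A A' φ f, ht A A' φ f]
  algebraMap_mem' r A A' φ f := by
    simp only [Pi.algebraMap_apply, AlgHom.commutes]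

/-- The canonical map `X_Ch(G)(A) → Hom(C(E, G), A)`, sending a point to evaluation there. -/
def evalPoint [IsLocalRing R] (A : DiscreteAlg R) (f : XCh F A.1 G) : chernRing F G →ₐ[R] A.1 where
  toFun s := s.1 A f
  map_one' := rfl
  map_mul' _ _ := rfl
  map_zero' := rfl
  map_add' _ _ := rfl
  commutes' _ := rfl

/-- The `m`-series `[m]_F(x)`. -/
def multSeries (F : FormalGroup R) (m : ℕ) : PowerSeries R :=
  let x : F.Point Unit := ⟨PowerSeries.X, PowerSeries.HasSubst.X'⟩
  (m • x).1

/-- The formal group law `F` over the local ring `R` has a reduction of height `n` (at the prime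
`p`): modulo the maximal ideal, `[p](x)` has leading term a unit multiple of `x ^ (p ^ n)`. -/
def ReductionHasHeight [IsLocalRing R] (F : FormalGroup R) (p n : ℕ) : Prop :=
  (multSeries (F.map (IsLocalRing.residue R)) p).order = ((p ^ n : ℕ) : ℕ∞)

end FormalGroups

end ChernApprox

end

/-!
A point of `X_Ch(G)` over `A` is determined by its values on finitely many irreducible
representations, which are monic polynomials with nilpotent lower coefficients. These coefficients
embed `X_Ch(G)` into an affine space, and the theorem follows from two facts about them.

*Bounded nilpotency* (`exists_coeff_pow_eq_zero`). Let `A` be an algebra over the residue field, `V`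
a representation and `ρ` the regular representation of `G`, of dimension `m`. The relation `V ⊗ ρ ≅
ρ ^ (dim V)` gives `∏ᵢⱼ (t - x(aᵢ + bⱼ)) = ∏ⱼ (t - x(bⱼ)) ^ (dim V)` when the divisors of `V` and
`ρ` are `∑ᵢ [aᵢ]` and `∑ⱼ [bⱼ]`. Hence, up to nilpotents, translation by `aᵢ` maps the finite set of
the `bⱼ` to itself. Going around a cycle shows that `m! aᵢ` vanishes up to nilpotents
(`coord_factorial_nsmul_pow_eq_zero`), and all exponents can be bounded in terms of `m` and `dim V`.
By the hypothesis on the height, the coordinate of `m! aᵢ` is a unit multiple of a fixed power of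
the coordinate of `aᵢ` (`exists_coord_nsmul_eq`). So the coordinates of the `aᵢ`, and with them the
coefficients of the divisor of `V`, are nilpotent of bounded order. The same relation shows that the
divisor of `V` has degree `dim V` (`XCh.isDivisorOfDegree`).

*Closedness* (`exists_xCh_of_jointly_injective`). The conditions on a point of `X_Ch(G)` can be
checked on a jointly injective family of algebras. The rules for products and exterior powers refer
to splittings of divisors into points, but a divisor over `A` has a universal splitting algebra,
which is free over `A`, so that these rules amount to equations between elements of `A`.

Representability is then formal (`CoordinateSystem`). Let `I_k` be the ideal of the polynomials in
the coordinates that vanish on all points over algebras killed by `𝔪 ^ k`. By closedness, the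
quotient by `I_k` represents the points over such algebras. By bounded nilpotency and Nakayama's
lemma, it is generated as a module by finitely many monomials, the same for all `k`. A natural
transformation is a compatible family of elements of these quotients. Since `I_k` is contained in
`I_{k+1}` up to multiples of `𝔪 ^ k`, and `E₀` is complete, such a family lifts to a single
combination of the monomials. Thus `C(E, G)` is generated by these monomials, and a homomorphism
from it to an algebra killed by `𝔪 ^ k` factors through the quotient by `I_k`.
-/

noncomputable section

namespace ChernApprox

/-! ### The coordinate of a point of a formal group -/

section FormalPoints

/-- `F(X, Y) = X + Y H(X, Y)` with `H(0, 0) = 1`, because `F(X, 0) = X`. -/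
theorem exists_eq_X_add_X_mul {R : Type u} [CommRing R] (F : FormalGroup R) :
    ∃ H : MvPowerSeries (Fin 2) R,
      F.toPowerSeries = MvPowerSeries.X 0 + MvPowerSeries.X 1 * H ∧
        MvPowerSeries.constantCoeff H = 1 := by
  have hdvd : (MvPowerSeries.X 1 : MvPowerSeries (Fin 2) R) ∣
      F.toPowerSeries - MvPowerSeries.X 0 := by
    rw [MvPowerSeries.X_dvd_iff]
    intro m hm
    have h := congrArg (PowerSeries.coeff (m 0)) F.Xzero_eq_X
    have key : PowerSeries.coeff (m 0) F.Xzero = MvPowerSeries.coeff m F.toPowerSeries := by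
      have hz : MvPowerSeries.HasSubst ![(PowerSeries.X : PowerSeries R), 0] :=
        MvPowerSeries.HasSubst.X_zero
      rw [PowerSeries.coeff, FormalGroup.Xzero, MvPowerSeries.coeff_subst hz,
        finsum_eq_single _ m]
      · have : PowerSeries.X ^ (m 0) =
            MvPowerSeries.monomial (Finsupp.single () (m 0)) (1 : R) := PowerSeries.X_pow_eq _
        simp [Finsupp.prod_fintype, hm, this]
      · intro d hd
        by_cases hd₁ : d 1 = 0
        · have hne : d 0 ≠ m 0 := fun h0 => hd (by
            ext i; fin_cases i
            · exact h0
            · exact hd₁.trans hm.symm)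
          have : PowerSeries.X ^ (d 0) =
              MvPowerSeries.monomial (Finsupp.single () (d 0)) (1 : R) := PowerSeries.X_pow_eq _
          simp only [Finsupp.prod_fintype, pow_zero, implies_true, Fin.prod_univ_two,
            Matrix.cons_val_zero, this, Matrix.cons_val_one, hd₁, mul_one]
          rw [MvPowerSeries.coeff_monomial_ne, smul_zero]
          intro h
          exact hne (by simpa using (DFunLike.congr_fun h ()).symm)
        · simp [Finsupp.prod_fintype, hd₁]
    rw [map_sub, ← key, h, sub_eq_zero, PowerSeries.coeff_X, MvPowerSeries.coeff_X]
    congr 1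
    rw [eq_iff_iff]
    constructor
    · intro h
      ext i; fin_cases i <;> simp [h, hm]
    · intro h
      rw [h]; simp
  obtain ⟨H, hH⟩ := hdvd
  have hF : F.toPowerSeries = MvPowerSeries.X 0 + MvPowerSeries.X 1 * H := by
    rw [← hH]; ring
  refine ⟨H, hF, ?_⟩
  have h := F.lin_coeff_Y
  rw [hF, map_add, MvPowerSeries.coeff_X, if_neg (by
    intro h; simpa using DFunLike.congr_fun h 1), zero_add] at h
  have := MvPowerSeries.coeff_add_monomial_mul (Finsupp.single (1 : Fin 2) 1) 0 H (1 : R)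
  rw [add_zero, one_mul] at this
  rw [← MvPowerSeries.coeff_zero_eq_constantCoeff_apply, ← this]
  exact h

variable {A : Type u} [CommRing A]

/-- The coordinate of a point with values in a ring: a point is a power series in no variables, and
its coordinate is the only coefficient. -/
abbrev pcoord {F : FormalGroup A} (a : F.Point PEmpty.{1}) : A := MvPowerSeries.constantCoeff a.1

theorem eq_C_constantCoeff (f : MvPowerSeries PEmpty.{1} A) :
    f = MvPowerSeries.C (MvPowerSeries.constantCoeff f) := by
  ext d
  rw [Subsingleton.elim d 0]
  simp

theorem pcoord_injective {F : FormalGroup A} {a b : F.Point PEmpty.{1}}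
    (h : pcoord a = pcoord b) : a = b := by
  apply Subtype.ext
  rw [eq_C_constantCoeff a.1, eq_C_constantCoeff b.1]
  exact congrArg _ h

theorem hasSubst_pair {F : FormalGroup A} {σ : Type*} (a b : F.Point σ) :
    MvPowerSeries.HasSubst ![a.1, b.1] :=
  MvPowerSeries.hasSubst_of_constantCoeff_nilpotent fun s => by
    fin_cases s
    · exact a.2
    · exact b.2

/-- The coordinate of `a + b` is that of `a` plus a unit multiple of that of `b`; in particular,
addition of points is cancellative. -/
theorem pcoord_add {F : FormalGroup A} (a b : F.Point PEmpty.{1}) :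
    ∃ w, IsNilpotent w ∧ pcoord (a + b) = pcoord a + pcoord b * (1 + w) := by
  obtain ⟨H, hF, hH⟩ := exists_eq_X_add_X_mul F
  have hs := hasSubst_pair a b
  refine ⟨MvPowerSeries.constantCoeff ((H - 1).subst ![a.1, b.1]),
    MvPowerSeries.IsNilpotent_subst hs (by simp [hH]), ?_⟩
  have h1 : H = 1 + (H - 1) := by ring
  have hone : (1 : MvPowerSeries (Fin 2) A).subst ![a.1, b.1] = 1 := by
    rw [← MvPowerSeries.coe_substAlgHom hs, map_one]
  rw [pcoord, FormalGroup.add_apply, hF, MvPowerSeries.subst_add hs, MvPowerSeries.subst_mul hs,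
    MvPowerSeries.subst_X hs, MvPowerSeries.subst_X hs]
  nth_rw 1 [h1]
  rw [MvPowerSeries.subst_add hs, hone]
  simp

theorem pcoord_zero {F : FormalGroup A} : pcoord (0 : F.Point PEmpty.{1}) = 0 := by
  simp [pcoord]

theorem eq_zero_of_add_eq_self {F : FormalGroup A} {a b : F.Point PEmpty.{1}} (h : a + b = a) :
    b = 0 := by
  obtain ⟨w, hw, hab⟩ := pcoord_add a b
  rw [h] at hab
  have h2 : pcoord b * (1 + w) = 0 := by linear_combination -hab
  apply pcoord_injective
  rw [pcoord_zero]
  exact (hw.isUnit_one_add).mul_left_eq_zero.1 h2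

/-- The coordinate of `m b` is `m` times that of `b`, up to a nilpotent multiple of the latter. -/
theorem pcoord_nsmul {F : FormalGroup A} (b : F.Point PEmpty.{1}) (m : ℕ) :
    ∃ w, IsNilpotent w ∧ pcoord (m • b) = pcoord b * (m + w) := by
  induction m with
  | zero => exact ⟨0, IsNilpotent.zero, by simp [pcoord_zero]⟩
  | succ m ih =>
    obtain ⟨w, hw, h⟩ := ih
    obtain ⟨w', hw', h'⟩ := pcoord_add (m • b) b
    refine ⟨w + w', (Commute.all _ _).isNilpotent_add hw hw', ?_⟩
    rw [succ_nsmul, h', h]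
    push_cast
    ring

/-- Multiples of a point are given by the `m`-series: substitution of the point for the variable is
additive, and takes the generic point `X` to the given one. -/
theorem map_subst_nsmul {k : Type u} [CommRing k] (F : FormalGroup k) (φ : k →+* A)
    (b : (F.map φ).Point PEmpty.{1}) (m : ℕ) :
    (m • b).1 = ((multSeries F m).map φ).subst b.1 := by
  set x : F.Point Unit := ⟨PowerSeries.X, PowerSeries.HasSubst.X'⟩ with hx
  have hb : PowerSeries.HasSubst b.1 := b.2
  show _ = PowerSeries.subst b.1 (PowerSeries.map φ (m • x).1)
  induction m with
  | zero =>
    rw [zero_nsmul, zero_nsmul, FormalGroup.zero_apply, FormalGroup.zero_apply]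
    rw [show PowerSeries.map φ (0 : MvPowerSeries Unit k) = 0 from map_zero _,
      ← PowerSeries.coe_substAlgHom hb, map_zero]
  | succ m ih =>
    rw [succ_nsmul, succ_nsmul, FormalGroup.add_apply, FormalGroup.add_apply, ih]
    have hs := hasSubst_pair (m • x) x
    have hs' : MvPowerSeries.HasSubst fun i => (![(m • x).1, x.1] i).map φ := hs.map φ
    have : PowerSeries.map φ (F.toPowerSeries.subst ![(m • x).1, x.1]) = _ :=
      MvPowerSeries.map_subst hs F.toPowerSeries
    rw [this]
    -- Both sides are the substitution of `([m](b), b)` into the group law.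
    refine Eq.trans ?_ (MvPowerSeries.subst_comp_subst_apply hs' hb.const _).symm
    show MvPowerSeries.subst _ (MvPowerSeries.map φ F.toPowerSeries) = _
    congr 1
    funext i
    fin_cases i
    · rfl
    · show b.1 = PowerSeries.subst b.1 (PowerSeries.map φ PowerSeries.X)
      rw [PowerSeries.map_X, PowerSeries.subst_X hb]

/-- Over a field over which `[m](x)` has order `h`, the coordinate of `m b` is a unit multiple of
the `h`-th power of the coordinate of `b`. -/
theorem exists_pcoord_nsmul_eq {k : Type u} [Field k] (F : FormalGroup k) (φ : k →+* A)
    (m h : ℕ) (hm : (multSeries F m).order = (h : ℕ∞)) (b : (F.map φ).Point PEmpty.{1}) :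
    ∃ w, IsUnit w ∧ pcoord (m • b) = w * pcoord b ^ h := by
  have hb : PowerSeries.HasSubst b.1 := b.2
  obtain ⟨g, hg⟩ := PowerSeries.X_pow_order_dvd (φ := multSeries F m)
  have hord : (multSeries F m).order.toNat = h := by rw [hm]; rfl
  rw [hord] at hg
  have hg0 : PowerSeries.constantCoeff g ≠ 0 := by
    intro h0
    have h1 : PowerSeries.coeff h (multSeries F m) ≠ 0 := by
      have := PowerSeries.coeff_order (φ := multSeries F m) (by
        intro h0; rw [h0, PowerSeries.order_zero] at hm; exact absurd hm (by simp))
      rwa [hord] at this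
    rw [hg] at h1
    apply h1
    have := PowerSeries.coeff_X_pow_mul g h 0
    rw [zero_add] at this
    rw [this, PowerSeries.coeff_zero_eq_constantCoeff_apply, h0]
  have hu : IsUnit g := PowerSeries.isUnit_iff_constantCoeff.2 (isUnit_iff_ne_zero.2 hg0)
  refine ⟨MvPowerSeries.constantCoeff (PowerSeries.subst b.1 (PowerSeries.map φ g)), ?_, ?_⟩
  · rw [← PowerSeries.coe_substAlgHom hb]
    exact ((hu.map (PowerSeries.map φ)).map (PowerSeries.substAlgHom hb)).map
      (MvPowerSeries.constantCoeff (R := A))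
  · rw [pcoord, map_subst_nsmul, hg, map_mul, map_pow, PowerSeries.map_X,
      PowerSeries.subst_mul hb, PowerSeries.subst_pow hb, PowerSeries.subst_X hb, map_mul, map_pow,
      mul_comm]

end FormalPoints

/-! ### Points with values in algebras -/

section GPoints

variable {R : Type u} [CommRing R] {F : FormalGroup R} {A B : Type u} [CommRing A] [Algebra R A]
  [CommRing B] [Algebra R B]

theorem GPoint.coord_injective : Function.Injective (GPoint.coord (F := F) (A := A)) :=
  fun _ _ h => pcoord_injective h

theorem GPoint.coord_zero : (0 : GPoint F A).coord = 0 := pcoord_zero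

/-- The point with a given nilpotent coordinate. -/
def GPoint.ofNilpotent (F : FormalGroup R) {x : A} (hx : IsNilpotent x) : GPoint F A :=
  ⟨MvPowerSeries.C x, by simpa [PowerSeries.HasSubst] using hx⟩

@[simp]
theorem GPoint.coord_ofNilpotent {x : A} (hx : IsNilpotent x) :
    (GPoint.ofNilpotent F hx).coord = x := by
  simp [GPoint.ofNilpotent, GPoint.coord]

/-- The functoriality of `𝔾`, as a homomorphism of monoids. -/
def GPoint.map (φ : A →ₐ[R] B) : GPoint F A →+ GPoint F B where
  toFun a := ⟨MvPowerSeries.map φ.toRingHom a.1, by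
    have : IsNilpotent (MvPowerSeries.constantCoeff a.1) := a.2
    simpa [PowerSeries.HasSubst] using this.map φ.toRingHom⟩
  map_zero' := Subtype.ext (_root_.map_zero _)
  map_add' a b := by
    apply Subtype.ext
    refine (MvPowerSeries.map_subst (hasSubst_pair a b) _).trans ?_
    show _ = MvPowerSeries.subst _ (F.map (algebraMap R B)).toPowerSeries
    have h : MvPowerSeries.map φ.toRingHom (F.map (algebraMap R A)).toPowerSeries =
        (F.map (algebraMap R B)).toPowerSeries := by
      rw [FormalGroup.map_toPowerSeries, FormalGroup.map_toPowerSeries]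
      ext d
      simp
    rw [h]
    congr 1
    funext i
    fin_cases i <;> rfl

@[simp]
theorem GPoint.coord_map (φ : A →ₐ[R] B) (a : GPoint F A) :
    (GPoint.map φ a).coord = φ a.coord :=
  MvPowerSeries.constantCoeff_map _ _

/-- A positive multiple of a point has, over algebras over the residue field, a coordinate which is
a unit multiple of a fixed power of the coordinate of that point. -/
theorem exists_coord_nsmul_eq [IsLocalRing R] {p n : ℕ} (hp : p.Prime)
    (hlocal : ∀ q : ℕ, q.Prime → q ≠ p → IsUnit (q : R)) (hF : ReductionHasHeight F p n) (N : ℕ)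
    (hN : N ≠ 0) :
    ∃ h : ℕ, ∀ (A : Type u) [CommRing A] [Algebra R A],
      IsLocalRing.maximalIdeal R ≤ RingHom.ker (algebraMap R A) →
      ∀ b : GPoint F A, ∃ w, IsUnit w ∧ (N • b).coord = w * b.coord ^ h := by
  induction N using induction_on_primes with
  | zero => exact absurd rfl hN
  | one => exact ⟨1, fun A _ _ _ b => ⟨1, isUnit_one, by simp⟩⟩
  | prime_mul q a hq ih =>
    obtain ⟨h, ih⟩ := ih (by rintro rfl; simp at hN)
    have key : ∃ h' : ℕ, ∀ (A : Type u) [CommRing A] [Algebra R A],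
        IsLocalRing.maximalIdeal R ≤ RingHom.ker (algebraMap R A) →
        ∀ b : GPoint F A, ∃ w, IsUnit w ∧ (q • b).coord = w * b.coord ^ h' := by
      by_cases hqp : q = p
      · -- The algebra is one over the residue field, where the height gives the order of `[p](x)`.
        subst hqp
        refine ⟨q ^ n, fun A _ _ hA b => ?_⟩
        let ψ : IsLocalRing.ResidueField R →+* A :=
          Ideal.Quotient.lift _ (algebraMap R A) fun r hr => hA hr
        have hψ : F.map (algebraMap R A) = (F.map (IsLocalRing.residue R)).map ψ := by
          apply FormalGroup.ext
          ext d
          simp only [FormalGroup.map_toPowerSeries, MvPowerSeries.coeff_map]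
          rfl
        have gen : ∀ F' : FormalGroup A, F' = (F.map (IsLocalRing.residue R)).map ψ →
            ∀ b : F'.Point PEmpty.{1}, ∃ w, IsUnit w ∧ pcoord (q • b) = w * pcoord b ^ q ^ n := by
          rintro _ rfl b
          exact exists_pcoord_nsmul_eq _ ψ q _ hF b
        exact gen _ hψ b
      · -- The coordinate of `q b` is that of `b` times `q` plus a nilpotent, and `q` is a unit.
        refine ⟨1, fun A _ _ _ b => ?_⟩
        obtain ⟨w, hw, h⟩ := pcoord_nsmul b q
        refine ⟨q + w, ?_, ?_⟩
        · have : IsUnit (q : A) := by simpa using (hlocal q hq hqp).map (algebraMap R A)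
          exact hw.isUnit_add_left_of_commute this (Commute.all _ _)
        · rw [pow_one, mul_comm]
          exact h
    obtain ⟨h', key⟩ := key
    refine ⟨h * h', fun A _ _ hA b => ?_⟩
    obtain ⟨w, hw, e⟩ := ih A hA b
    obtain ⟨w', hw', e'⟩ := key A hA (a • b)
    refine ⟨w' * w ^ h', hw'.mul (hw.pow _), ?_⟩
    rw [mul_nsmul', e', e, mul_pow, pow_mul, mul_assoc]

end GPoints

/-! ### Equations of divisors -/

section DivisorEquations

variable {A B : Type u} [CommRing A] [CommRing B]

/-- The equation of a divisor. -/
def DivPlus.eqn (D : DivPlus A) : A[X] := D.toMul.1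

theorem DivPlus.isDivisor (D : DivPlus A) : IsDivisor D.eqn := D.toMul.2

theorem DivPlus.eqn_injective : Function.Injective (DivPlus.eqn (A := A)) := fun _ _ h =>
  Additive.toMul.injective (Subtype.ext h)

/-- The divisor with a given equation. -/
def DivPlus.ofEqn (f : A[X]) (hf : IsDivisor f) : DivPlus A := Additive.ofMul ⟨f, hf⟩

@[simp]
theorem DivPlus.eqn_zero : (0 : DivPlus A).eqn = 1 := rfl

@[simp]
theorem DivPlus.eqn_add (D D' : DivPlus A) : (D + D').eqn = D.eqn * D'.eqn := rfl

@[simp]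
theorem DivPlus.eqn_map (φ : A →+* B) (D : DivPlus A) : (DivPlus.map φ D).eqn = D.eqn.map φ := rfl

@[simp]
theorem DivPlus.eqn_sum {ι : Type*} (s : Finset ι) (D : ι → DivPlus A) :
    (∑ i ∈ s, D i).eqn = ∏ i ∈ s, (D i).eqn := by
  classical
  induction s using Finset.induction_on with
  | empty => simp
  | insert i s hi ih => rw [Finset.sum_insert hi, Finset.prod_insert hi, DivPlus.eqn_add, ih]

@[simp]
theorem DivPlus.eqn_nsmul (m : ℕ) (D : DivPlus A) : (m • D).eqn = D.eqn ^ m := by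
  induction m with
  | zero => simp
  | succ m ih => rw [succ_nsmul, pow_succ, DivPlus.eqn_add, ih]

@[simp]
theorem GPoint.eqn_div {R : Type u} [CommRing R] {F : FormalGroup R} [Algebra R A]
    (a : GPoint F A) : a.div.eqn = Polynomial.X - Polynomial.C a.coord := rfl

end DivisorEquations

/-! ### Finite generation of `R⁺(G)` -/

section RepGenerators

variable {G : Type v} [Group G]

namespace RepPlus

theorem mk_eq_mk {V W : FDRep ℂ G} (e : V ≃ₗ[ℂ] W)
    (h : ∀ g x, e (V.ρ g x) = W.ρ g (e x)) : mk V = mk W :=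
  Quotient.sound (isIsomorphic_of_equivariant e fun g => LinearMap.ext fun x => h g x)

theorem mk_eq_zero_of_subsingleton (V : FDRep ℂ G) [Subsingleton V] : mk V = 0 :=
  mk_eq_mk (W := FDRep.of (Representation.trivial ℂ G PUnit.{1}))
    { toFun := fun _ => PUnit.unit, invFun := fun _ => 0, map_add' := fun _ _ => rfl,
      map_smul' := fun _ _ => rfl, left_inv := fun _ => Subsingleton.elim _ _,
      right_inv := fun _ => rfl } fun _ _ => rfl

theorem mk_eq_add_of_isCompl (V : FDRep ℂ G) {W W' : Subrepresentation V.ρ}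
    (h : IsCompl W.toSubmodule W'.toSubmodule) :
    mk V = mk (FDRep.of W.toRepresentation) + mk (FDRep.of W'.toRepresentation) := by
  symm
  refine mk_eq_mk (V := FDRep.of (Representation.prod W.toRepresentation W'.toRepresentation))
    (Submodule.prodEquivOfIsCompl _ _ h) fun g x => ?_
  refine (Submodule.coe_prodEquivOfIsCompl' _ _ h _).trans ?_
  refine Eq.trans ?_ (congrArg (V.ρ g) (Submodule.coe_prodEquivOfIsCompl' _ _ h x).symm)
  exact (_root_.map_add (V.ρ g) _ _).symm

end RepPlus

/-- There are finitely many isomorphism classes of irreducible representations: each of them is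
isomorphic to a summand of the group algebra. -/
theorem exists_finite_irreducibles (G : Type v) [Group G] [Finite G] :
    ∃ (r : ℕ) (s : Fin r → FDRep.{0} ℂ G), ∀ V : FDRep.{0} ℂ G,
      Representation.IsIrreducible V.ρ → ∃ i, RepPlus.mk V = RepPlus.mk (s i) := by
  classical
  obtain ⟨r, S, e, hS⟩ := IsSemisimpleModule.exists_linearEquiv_fin_dfinsupp
    (MonoidAlgebra ℂ G) (MonoidAlgebra ℂ G)
  -- The simple summands of the group algebra may live in another universe than the
  -- representations; a summand that is not isomorphic to any of these contributes a dummy.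
  refine ⟨r, fun i => if h : ∃ V : FDRep.{0} ℂ G,
    Nonempty (S i ≃ₗ[MonoidAlgebra ℂ G] Representation.asModule V.ρ) then h.choose else
      FDRep.of (Representation.trivial ℂ G PUnit.{1}), fun V hV => ?_⟩
  have hsimple : IsSimpleModule (MonoidAlgebra ℂ G) (Representation.asModule V.ρ) :=
    (Representation.irreducible_iff_isSimpleModule_asModule V.ρ).1 hV
  have := IsSimpleModule.nontrivial (MonoidAlgebra ℂ G) (Representation.asModule V.ρ)
  obtain ⟨v, hv⟩ := exists_ne (0 : Representation.asModule V.ρ)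
  let f : MonoidAlgebra ℂ G →ₗ[MonoidAlgebra ℂ G] Representation.asModule V.ρ :=
    LinearMap.toSpanSingleton _ _ v
  -- The nonzero map `x ↦ x v` is nonzero on some simple summand, and then bijective there.
  obtain ⟨i, hi⟩ : ∃ i, (f ∘ₗ e.symm.toLinearMap) ∘ₗ DFinsupp.lsingle i ≠ 0 := by
    by_contra! hcon
    have h0 : f ∘ₗ e.symm.toLinearMap = 0 := DFinsupp.lhom_ext' fun i => by
      rw [hcon i, LinearMap.zero_comp]
    apply hv
    have := LinearMap.congr_fun h0 (e 1)
    simpa [f] using this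
  have hbij := LinearMap.bijective_of_ne_zero hi
  have hex : ∃ V : FDRep.{0} ℂ G,
      Nonempty (S i ≃ₗ[MonoidAlgebra ℂ G] Representation.asModule V.ρ) :=
    ⟨V, ⟨LinearEquiv.ofBijective _ hbij⟩⟩
  refine ⟨i, ?_⟩
  beta_reduce
  rw [dif_pos hex]
  let E : Representation.asModule V.ρ ≃ₗ[MonoidAlgebra ℂ G] Representation.asModule hex.choose.ρ :=
    (LinearEquiv.ofBijective _ hbij).symm.trans hex.choose_spec.some
  refine RepPlus.mk_eq_mk ((Representation.asModuleEquiv V.ρ).symm.trans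
    ((E.restrictScalars ℂ).trans (Representation.asModuleEquiv hex.choose.ρ))) fun g x => ?_
  have h1 := E.map_smul (MonoidAlgebra.of ℂ G g) ((Representation.asModuleEquiv V.ρ).symm x)
  simp only [LinearEquiv.trans_apply, LinearEquiv.restrictScalars_apply]
  rw [Representation.asModuleEquiv_symm_map_rho, h1, Representation.asModuleEquiv_map_smul]
  simp

/-- The monoid `R⁺(G)` is finitely generated, in the form used here: every additive function on it
is a combination, with fixed coefficients, of its values on finitely many representations. -/
theorem exists_repPlus_generators (G : Type v) [Group G] [Finite G] :
    ∃ (r : ℕ) (s : Fin r → FDRep.{0} ℂ G) (c : RepPlus G → Fin r → ℕ),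
      ∀ (M : Type u) [AddCommMonoid M] (φ : RepPlus G → M), φ 0 = 0 →
        (∀ V W, φ (V + W) = φ V + φ W) → ∀ V, φ V = ∑ i, c V i • φ (RepPlus.mk (s i)) := by
  classical
  obtain ⟨r, s, hs⟩ := exists_finite_irreducibles G
  have key : ∀ (d : ℕ) (V : FDRep.{0} ℂ G), Module.finrank ℂ V = d → ∃ c : Fin r → ℕ,
      ∀ (M : Type u) [AddCommMonoid M] (φ : RepPlus G → M), φ 0 = 0 →
        (∀ V W, φ (V + W) = φ V + φ W) →
          φ (RepPlus.mk V) = ∑ i, c i • φ (RepPlus.mk (s i)) := by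
    intro d
    induction d using Nat.strong_induction_on with
    | _ d ih =>
      intro V hV
      by_cases hsub : Subsingleton V
      · refine ⟨0, fun M _ φ h0 _ => ?_⟩
        rw [RepPlus.mk_eq_zero_of_subsingleton, h0]
        simp
      by_cases hirr : Representation.IsIrreducible V.ρ
      · obtain ⟨i, hi⟩ := hs V hirr
        refine ⟨Pi.single i 1, fun M _ φ h0 _ => ?_⟩
        rw [hi, Finset.sum_eq_single i]
        · simp
        · intro j _ hj
          simp [hj]
        · simp
      · have hnt : Nontrivial V := not_subsingleton_iff_nontrivial.1 hsub
        have : Nontrivial (Subrepresentation V.ρ) := ⟨⊥, ⊤, fun h => by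
          have := congrArg Subrepresentation.toSubmodule h
          exact bot_ne_top (α := Submodule ℂ V) this⟩
        obtain ⟨W, hW⟩ : ∃ W : Subrepresentation V.ρ, ¬ (W = ⊥ ∨ W = ⊤) := by
          by_contra! hcon
          exact hirr ⟨hcon⟩
        rw [not_or] at hW
        obtain ⟨W', hW'⟩ := exists_isCompl W
        have hcompl : IsCompl W.toSubmodule W'.toSubmodule := by
          refine ⟨disjoint_iff.2 ?_, codisjoint_iff.2 ?_⟩
          · exact congrArg Subrepresentation.toSubmodule hW'.inf_eq_bot
          · exact congrArg Subrepresentation.toSubmodule hW'.sup_eq_top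
        have hW1 : W.toSubmodule ≠ ⊤ := fun h =>
          hW.2 (Subrepresentation.toSubmodule_injective h)
        have hW2 : W'.toSubmodule ≠ ⊤ := fun h => hW.1 (by
          have := hW'.inf_eq_bot
          rwa [show W' = ⊤ from Subrepresentation.toSubmodule_injective h, inf_top_eq] at this)
        obtain ⟨c, hc⟩ := ih _ (hV ▸ Submodule.finrank_lt hW1)
          (FDRep.of W.toRepresentation) rfl
        obtain ⟨c', hc'⟩ := ih _ (hV ▸ Submodule.finrank_lt hW2)
          (FDRep.of W'.toRepresentation) rfl
        refine ⟨c + c', fun M _ φ h0 hadd => ?_⟩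
        rw [RepPlus.mk_eq_add_of_isCompl V hcompl, hadd, hc M φ h0 hadd, hc' M φ h0 hadd,
          ← Finset.sum_add_distrib]
        exact Finset.sum_congr rfl fun i _ => (add_nsmul _ _ _).symm
  choose c hc using fun V : RepPlus G => key _ (Quotient.out V) rfl
  refine ⟨r, s, c, fun M _ φ h0 hadd V => ?_⟩
  rw [← hc V M φ h0 hadd]
  exact congrArg φ (Quotient.out_eq V).symm

end RepGenerators

/-! ### The regular representation -/

section RegularRepresentation

variable {G : Type v} [Group G] {X : Type} [Fintype X]

/-- The functions on `G` with values in `W`, with `G` acting by left translation of the argument.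
They are encoded as functions on a set `X` in bijection with `G`, to allow `G` to live in any
universe. -/
def translationRep (e : G ≃ X) (W : Type) [AddCommGroup W] [Module ℂ W] :
    Representation ℂ G (X → W) where
  toFun g := LinearMap.funLeft ℂ W fun x => e (g⁻¹ * e.symm x)
  map_one' := by
    ext f x
    simp [LinearMap.funLeft]
  map_mul' g h := by
    ext f x
    simp [LinearMap.funLeft, mul_assoc]

/-- The regular representation, on the functions on a set in bijection with `G`. -/
abbrev regularRep (e : G ≃ X) : FDRep.{0} ℂ G := FDRep.of (translationRep e ℂ)

/-- `translationRep e (Fin d → ℂ)` is the sum of `d` copies of the regular representation, which is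
expressed through an additive function `φ`. -/
theorem map_mk_translationRep (e : G ≃ X) {M : Type u} [AddCommMonoid M] (φ : RepPlus G → M)
    (h0 : φ 0 = 0) (hadd : ∀ V W, φ (V + W) = φ V + φ W) (d : ℕ) :
    φ (RepPlus.mk (FDRep.of (translationRep e (Fin d → ℂ)))) =
      d • φ (RepPlus.mk (regularRep e)) := by
  induction d with
  | zero =>
    have : Subsingleton (FDRep.of (translationRep e (Fin 0 → ℂ))) :=
      inferInstanceAs (Subsingleton (X → Fin 0 → ℂ))
    rw [RepPlus.mk_eq_zero_of_subsingleton, h0, zero_smul]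
  | succ d ih =>
    rw [succ_nsmul', ← ih, ← hadd]
    congr 1
    exact RepPlus.mk_eq_mk (V := FDRep.of (translationRep e (Fin (d + 1) → ℂ)))
      (W := FDRep.of (Representation.prod (translationRep e ℂ) (translationRep e (Fin d → ℂ))))
      { toFun := fun F => (fun x => F x 0, fun x i => F x i.succ)
        invFun := fun F x => Fin.cons (F.1 x) (F.2 x)
        map_add' := fun _ _ => rfl
        map_smul' := fun _ _ => rfl
        left_inv := fun F => by
          funext x i
          refine Fin.cases ?_ (fun i => ?_) i <;> rfl
        right_inv := fun F => rfl } fun g F => rfl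

/-- Tensoring with the regular representation forgets the action: `v ⊗ f` can be untwisted to the
function `x ↦ f(x) x⁻¹ v`. -/
theorem mk_mul_regularRep (e : G ≃ X) (V : FDRep.{0} ℂ G) :
    RepPlus.mk V * RepPlus.mk (regularRep e) =
      RepPlus.mk (FDRep.of (translationRep e (Fin (Module.finrank ℂ V) → ℂ))) := by
  classical
  -- `T` turns the diagonal action on functions `G → V` into translation of the argument alone.
  let T : (X → V) ≃ₗ[ℂ] (X → V) :=
    { toFun := fun F x => V.ρ (e.symm x)⁻¹ (F x)
      invFun := fun F x => V.ρ (e.symm x) (F x)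
      map_add' := fun _ _ => funext fun _ => _root_.map_add _ _ _
      map_smul' := fun _ _ => funext fun _ => _root_.map_smul _ _ _
      left_inv := fun F => funext fun x => by
        beta_reduce
        rw [← Module.End.mul_apply, ← _root_.map_mul, mul_inv_cancel, _root_.map_one,
          Module.End.one_apply]
      right_inv := fun F => funext fun x => by
        beta_reduce
        rw [← Module.End.mul_apply, ← _root_.map_mul, inv_mul_cancel, _root_.map_one,
          Module.End.one_apply] }
  let b := (Module.finBasis ℂ V).equivFun
  refine RepPlus.mk_eq_mk (V := FDRep.of (Representation.tprod V.ρ (translationRep e ℂ)))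
    ((TensorProduct.piScalarRight ℂ ℂ V X).trans
      (T.trans (LinearEquiv.piCongrRight fun _ => b))) fun g z => ?_
  induction z using TensorProduct.induction_on with
  | zero => simp only [_root_.map_zero]
  | add z w hz hw => simp only [_root_.map_add, hz, hw]
  | tmul v f =>
    funext x
    show b (V.ρ (e.symm x)⁻¹ (f (e (g⁻¹ * e.symm x)) • V.ρ g v)) =
      b (V.ρ (e.symm (e (g⁻¹ * e.symm x)))⁻¹ (f (e (g⁻¹ * e.symm x)) • v))
    simp only [_root_.map_smul]
    rw [← Module.End.mul_apply, ← _root_.map_mul, Equiv.symm_apply_apply, mul_inv_rev, inv_inv]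

/-- The regular representation contains the trivial one. -/
theorem exists_mk_regularRep_eq [Finite G] (e : G ≃ X) :
    ∃ W : RepPlus G, RepPlus.mk (regularRep e) = 1 + W := by
  -- The trivial summand consists of the constant functions.
  let c : ℂ →ₗ[ℂ] (X → ℂ) := LinearMap.pi fun _ => LinearMap.id
  have hc : Function.Injective c := fun a b h => congrFun h (e 1)
  let W : Subrepresentation (regularRep e).ρ :=
    { toSubmodule := LinearMap.range c
      apply_mem_toSubmodule := by
        rintro g _ ⟨a, rfl⟩
        exact ⟨a, rfl⟩ }
  obtain ⟨W', hW'⟩ := exists_isCompl W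
  have hcompl : IsCompl W.toSubmodule W'.toSubmodule := by
    refine ⟨disjoint_iff.2 ?_, codisjoint_iff.2 ?_⟩
    · exact congrArg Subrepresentation.toSubmodule hW'.inf_eq_bot
    · exact congrArg Subrepresentation.toSubmodule hW'.sup_eq_top
  refine ⟨RepPlus.mk (FDRep.of W'.toRepresentation), ?_⟩
  rw [RepPlus.mk_eq_add_of_isCompl _ hcompl]
  congr 1
  symm
  refine RepPlus.mk_eq_mk (V := FDRep.of (Representation.trivial ℂ G ℂ))
    (LinearEquiv.ofInjective c hc) fun g x => ?_
  exact Subtype.ext rfl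

end RegularRepresentation

/-! ### Universal splitting algebras -/

section Splitting

open Polynomial in
/-- The universal splitting algebra of a monic polynomial: it is free, and it corepresents the
factorizations of the polynomial into linear factors. -/
theorem exists_universal_splitting (d : ℕ) {A : Type u} [CommRing A] [Nontrivial A] (f : A[X])
    (hf : f.Monic) (hd : f.natDegree = d) :
    ∃ (U : Type u) (_ : CommRing U) (_ : Algebra A U), Module.Free A U ∧ Nontrivial U ∧
      ∃ a : Fin d → U, f.map (algebraMap A U) = ∏ i, (X - C (a i)) ∧
        ∀ (B : Type u) [CommRing B] (φ : A →+* B) (b : Fin d → B),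
          f.map φ = ∏ i, (X - C (b i)) →
            ∃ ψ : U →+* B, ψ.comp (algebraMap A U) = φ ∧ ∀ i, ψ (a i) = b i := by
  induction d generalizing A with
  | zero =>
    refine ⟨A, inferInstance, Algebra.id A, inferInstance, inferInstance, Fin.elim0, ?_, ?_⟩
    · rw [hf.natDegree_eq_zero.1 hd]
      simp
    · intro B _ φ b _
      exact ⟨φ, RingHom.ext fun _ => rfl, fun i => i.elim0⟩
  | succ d ih =>
    have : Nontrivial (AdjoinRoot f) := by
      refine Ideal.Quotient.nontrivial_iff.2 fun htop => ?_
      rw [Ideal.span_singleton_eq_top] at htop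
      rw [hf.eq_one_of_isUnit htop, natDegree_one] at hd
      exact absurd hd (Nat.succ_ne_zero d).symm
    -- Adjoin one root, and split the cofactor `g` over the extension.
    set g : (AdjoinRoot f)[X] := f.map (AdjoinRoot.of f) /ₘ (X - C (AdjoinRoot.root f)) with hg
    have hfg : (X - C (AdjoinRoot.root f)) * g = f.map (AdjoinRoot.of f) := by
      rw [hg, mul_divByMonic_eq_iff_isRoot]
      exact AdjoinRoot.isRoot_root f
    have hgm : g.Monic := (monic_X_sub_C _).of_mul_monic_left (hfg ▸ hf.map _)
    have hgd : g.natDegree = d := by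
      have := congrArg natDegree hfg
      rw [(monic_X_sub_C _).natDegree_mul hgm, natDegree_X_sub_C, hf.natDegree_map, hd] at this
      omega
    obtain ⟨U, _, _, hfree, hnt, a, ha, huniv⟩ := ih g hgm hgd
    let _ : Algebra A U := ((algebraMap (AdjoinRoot f) U).comp (AdjoinRoot.of f)).toAlgebra
    have : IsScalarTower A (AdjoinRoot f) U := IsScalarTower.of_algebraMap_eq fun _ => rfl
    have : Module.Free A (AdjoinRoot f) := hf.free_adjoinRoot
    refine ⟨U, inferInstance, inferInstance, Module.Free.trans (S := AdjoinRoot f), hnt,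
      Fin.cons (algebraMap _ U (AdjoinRoot.root f)) a, ?_, ?_⟩
    · rw [Fin.prod_univ_succ]
      simp only [Fin.cons_zero, Fin.cons_succ]
      rw [← ha]
      have : f.map (algebraMap A U) = (f.map (AdjoinRoot.of f)).map (algebraMap _ U) := by
        rw [Polynomial.map_map]; rfl
      rw [this, ← hfg]
      simp
    · intro B _ φ b hb
      rw [Fin.prod_univ_succ] at hb
      have hroot : f.eval₂ φ (b 0) = 0 := by
        rw [← Polynomial.eval_map, hb]
        simp
      let χ : AdjoinRoot f →+* B := AdjoinRoot.lift φ (b 0) hroot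
      have hχ : χ.comp (AdjoinRoot.of f) = φ := AdjoinRoot.lift_comp_of hroot
      have hχr : χ (AdjoinRoot.root f) = b 0 := AdjoinRoot.lift_root hroot
      obtain ⟨ψ, hψ, hψa⟩ := huniv B χ (fun i => b i.succ) (by
        apply (monic_X_sub_C (b 0)).isRegular.left
        show (X - C (b 0)) * _ = _
        beta_reduce
        rw [← hb, ← hχ, ← Polynomial.map_map, ← hfg]
        simp [hχr])
      refine ⟨ψ, ?_, fun i => ?_⟩
      · rw [← hχ, ← hψ]
        rfl
      · refine Fin.cases ?_ (fun i => ?_) i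
        · rw [Fin.cons_zero, ← hχr, ← hψ]
          rfl
        · rw [Fin.cons_succ]
          exact hψa i

open Polynomial in
/-- The universal algebra over which two given monic polynomials split. -/
theorem exists_universal_splitting_pair {d e : ℕ} {A : Type u} [CommRing A] [Nontrivial A]
    (f g : A[X]) (hf : f.Monic) (hd : f.natDegree = d) (hg : g.Monic) (he : g.natDegree = e) :
    ∃ (U : Type u) (_ : CommRing U) (_ : Algebra A U), Module.Free A U ∧ Nontrivial U ∧
      ∃ (a : Fin d → U) (b : Fin e → U), f.map (algebraMap A U) = ∏ i, (X - C (a i)) ∧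
        g.map (algebraMap A U) = ∏ i, (X - C (b i)) ∧
        ∀ (B : Type u) [CommRing B] (φ : A →+* B) (a' : Fin d → B) (b' : Fin e → B),
          f.map φ = ∏ i, (X - C (a' i)) → g.map φ = ∏ i, (X - C (b' i)) →
            ∃ ψ : U →+* B, ψ.comp (algebraMap A U) = φ ∧ (∀ i, ψ (a i) = a' i) ∧
              ∀ i, ψ (b i) = b' i := by
  obtain ⟨U₁, _, _, hfree₁, hnt₁, a, ha, huniv₁⟩ := exists_universal_splitting d f hf hd
  obtain ⟨U, _, _, hfree, hnt, b, hb, huniv⟩ := exists_universal_splitting e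
    (g.map (algebraMap A U₁)) (hg.map _) ((hg.natDegree_map _).trans he)
  let _ : Algebra A U := ((algebraMap U₁ U).comp (algebraMap A U₁)).toAlgebra
  have : IsScalarTower A U₁ U := IsScalarTower.of_algebraMap_eq fun _ => rfl
  refine ⟨U, inferInstance, inferInstance, Module.Free.trans (S := U₁), hnt,
    fun i => algebraMap U₁ U (a i), b, ?_, ?_, ?_⟩
  · have : f.map (algebraMap A U) = (f.map (algebraMap A U₁)).map (algebraMap U₁ U) := by
      rw [Polynomial.map_map]; rfl
    rw [this, ha, Polynomial.map_prod]
    simp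
  · rw [← hb, Polynomial.map_map]
    rfl
  · intro B _ φ a' b' ha' hb'
    obtain ⟨ψ₁, h₁, h₁a⟩ := huniv₁ B φ a' ha'
    obtain ⟨ψ, h, hψb⟩ := huniv B ψ₁ b' (by rw [Polynomial.map_map, h₁, hb'])
    refine ⟨ψ, ?_, fun i => ?_, hψb⟩
    · rw [← h₁, ← h]
      rfl
    · rw [← h₁a, ← h]
      rfl

/-- Vanishing in the base change of a free algebra is detected by the coordinates. -/
theorem exists_baseChange {A U B : Type u} [CommRing A] [CommRing U] [Algebra A U]
    [Module.Free A U] [CommRing B] (φ : A →+* B) :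
    ∃ (V : Type u) (_ : CommRing V) (j : U →+* V) (l : B →+* V),
      l.comp φ = j.comp (algebraMap A U) ∧
        ∀ z, j z = 0 → ∀ k, φ ((Module.Free.chooseBasis A U).repr z k) = 0 := by
  let _ : Algebra A B := φ.toAlgebra
  refine ⟨TensorProduct A B U, inferInstance,
    (Algebra.TensorProduct.includeRight (R := A) (A := B) (B := U)).toRingHom,
    (Algebra.TensorProduct.includeLeft (R := A) (S := A) (A := B) (B := U)).toRingHom, ?_, ?_⟩
  · ext x
    exact ((Algebra.TensorProduct.includeLeft (R := A) (S := A) (A := B) (B := U)).commutes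
      x).trans
        ((Algebra.TensorProduct.includeRight (R := A) (A := B) (B := U)).commutes x).symm
  · intro z hz k
    have h := Algebra.TensorProduct.basis_repr_tmul (A := B) (Module.Free.chooseBasis A U) 1 z
    have hz' : (1 : B) ⊗ₜ[A] z = 0 := hz
    rw [hz', map_zero, one_smul] at h
    have h' := (DFunLike.congr_fun h k).symm
    rwa [Finsupp.mapRange_apply] at h'

theorem IsDivisorOfDegree.isNilpotent_of_isRoot {A : Type u} [CommRing A] {d : ℕ} {f : A[X]}
    (hf : IsDivisorOfDegree d f) {a : A} (ha : f.IsRoot a) : IsNilpotent a := by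
  have h := (isDivisorOfDegree_iff.1 hf).2.2
  have h1 := congrArg (Polynomial.eval (Ideal.Quotient.mk (nilradical A) a)) h
  rw [Polynomial.eval_map_apply, ha.eq_zero, map_zero, Polynomial.eval_pow, Polynomial.eval_X,
    ← map_pow] at h1
  have h2 : IsNilpotent (a ^ d) := Ideal.Quotient.eq_zero_iff_mem.1 h1.symm
  obtain ⟨m, hm⟩ := h2
  exact ⟨d * m, by rw [pow_mul, hm]⟩

theorem IsDivisorOfDegree.isNilpotent_of_eq_prod {A : Type u} [CommRing A] {d m : ℕ} {f : A[X]}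
    (hf : IsDivisorOfDegree d f) {a : Fin m → A}
    (ha : f = ∏ i, (Polynomial.X - Polynomial.C (a i))) (i : Fin m) : IsNilpotent (a i) := by
  refine hf.isNilpotent_of_isRoot ?_
  rw [ha, Polynomial.IsRoot.def, Polynomial.eval_prod]
  exact Finset.prod_eq_zero (Finset.mem_univ i) (by simp)

theorem IsDivisorOfDegree.monic {A : Type u} [CommRing A] {d : ℕ} {f : A[X]}
    (hf : IsDivisorOfDegree d f) : f.Monic := by
  nontriviality A
  exact Polynomial.monic_of_natDegree_le_of_coeff_eq_one d (isDivisorOfDegree_iff.1 hf).2.1 hf.1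

theorem IsDivisorOfDegree.natDegree {A : Type u} [CommRing A] [Nontrivial A] {d : ℕ} {f : A[X]}
    (hf : IsDivisorOfDegree d f) : f.natDegree = d :=
  le_antisymm (isDivisorOfDegree_iff.1 hf).2.1
    (Polynomial.le_natDegree_of_ne_zero (by rw [hf.1]; exact one_ne_zero))

end Splitting

/-! ### Closedness of the conditions on points -/

section SplitRules

variable {R : Type u} [CommRing R] (F : FormalGroup R) {d e : ℕ}

/-- A construction of a polynomial from a family of `d` points and a family of `e` points of `𝔾`
with values in a common algebra. -/
abbrev PointRule (d e : ℕ) : Type (u + 1) :=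
  ∀ (B : Type u) [CommRing B] [Algebra R B], (Fin d → GPoint F B) → (Fin e → GPoint F B) → B[X]

variable {F}

/-- Naturality of a construction on points. -/
def PointRule.IsNatural (T : PointRule F d e) : Prop :=
  ∀ (B B' : Type u) [CommRing B] [CommRing B'] [Algebra R B] [Algebra R B'] (φ : B →ₐ[R] B')
    (a : Fin d → GPoint F B) (b : Fin e → GPoint F B),
    (T B a b).map φ.toRingHom =
      T B' (fun i => GPoint.map φ (a i)) (fun j => GPoint.map φ (b j))

variable {A : Type u} [CommRing A] [Algebra R A]

/-- `P` is the result of applying the construction `T` to the divisors with equations `f` and `g`: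
this is so after every base change over which both of these are sums of points. -/
def PointRule.Holds (T : PointRule F d e) (f g P : A[X]) : Prop :=
  ∀ (B : Type u) [CommRing B] [Algebra R B] (φ : A →ₐ[R] B) (a : Fin d → GPoint F B)
    (b : Fin e → GPoint F B),
    f.map φ.toRingHom = ∏ i, (Polynomial.X - Polynomial.C (a i).coord) →
    g.map φ.toRingHom = ∏ j, (Polynomial.X - Polynomial.C (b j).coord) →
      P.map φ.toRingHom = T B a b

/-- The validity of a natural construction is a closed condition: it can be checked on a jointly
injective family of algebras. The universal splitting algebra `U` is free over `A`, and so embeds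
into the product of its base changes; the condition over `U` implies all others. -/
theorem PointRule.Holds.of_jointly_injective {T : PointRule F d e} (hT : T.IsNatural)
    {f g P : A[X]} (hf : IsDivisorOfDegree d f) (hg : IsDivisorOfDegree e g)
    (hinj : ∀ x : A, (∀ (B : Type u) [CommRing B] [Algebra R B] (φ : A →ₐ[R] B),
      T.Holds (f.map φ.toRingHom) (g.map φ.toRingHom) (P.map φ.toRingHom) → φ x = 0) → x = 0) :
    T.Holds f g P := by
  intro B _ _ φ a b ha hb
  rcases subsingleton_or_nontrivial A with hA | hA
  · have : Subsingleton B := by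
      rw [← subsingleton_iff_zero_eq_one, ← map_zero φ, ← map_one φ, Subsingleton.elim (0 : A) 1]
    exact Subsingleton.elim _ _
  obtain ⟨U, _, _, hfree, _, a₀, b₀, ha₀, hb₀, huniv⟩ := exists_universal_splitting_pair f g
    hf.monic hf.natDegree hg.monic hg.natDegree
  let _ : Algebra R U := ((algebraMap A U).comp (algebraMap R A)).toAlgebra
  let ι : A →ₐ[R] U := { algebraMap A U with commutes' := fun _ => rfl }
  have hι : ι.toRingHom = algebraMap A U := rfl
  have hna := (hf.map (algebraMap A U)).isNilpotent_of_eq_prod ha₀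
  have hnb := (hg.map (algebraMap A U)).isNilpotent_of_eq_prod hb₀
  let α : Fin d → GPoint F U := fun i => GPoint.ofNilpotent F (hna i)
  let β : Fin e → GPoint F U := fun i => GPoint.ofNilpotent F (hnb i)
  -- Over `U` the equation is one between coefficients, which is checked on a basis of `U`.
  have key : P.map (algebraMap A U) = T U α β := by
    rw [← sub_eq_zero]
    ext k
    rw [Polynomial.coeff_zero]
    set z := (P.map (algebraMap A U) - T U α β).coeff k with hz
    apply (Module.Free.chooseBasis A U).repr.injective
    rw [map_zero]
    ext k'
    rw [Finsupp.zero_apply]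
    refine hinj _ fun B' _ _ φ' hφ' => ?_
    obtain ⟨V, _, j, l, hjl, hV⟩ := exists_baseChange (U := U) φ'.toRingHom
    refine hV z ?_ k'
    let _ : Algebra R V := (l.comp (algebraMap R B')).toAlgebra
    let l' : B' →ₐ[R] V := { l with commutes' := fun _ => rfl }
    have hl' : l'.toRingHom = l := rfl
    let j' : U →ₐ[R] V := { j with
      commutes' := fun r => by
        show j (algebraMap A U (algebraMap R A r)) = l (algebraMap R B' r)
        rw [← φ'.commutes r]
        exact (RingHom.congr_fun hjl (algebraMap R A r)).symm }
    have hj' : j'.toRingHom = j := rfl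
    have h := hφ' V l' (fun i => GPoint.map j' (α i)) (fun i => GPoint.map j' (β i)) (by
      rw [Polynomial.map_map, hl', hjl, ← Polynomial.map_map, ha₀, Polynomial.map_prod]
      refine Finset.prod_congr rfl fun i _ => ?_
      simp only [α, GPoint.coord_map, GPoint.coord_ofNilpotent, Polynomial.map_sub,
        Polynomial.map_X, Polynomial.map_C]
      rfl) (by
      rw [Polynomial.map_map, hl', hjl, ← Polynomial.map_map, hb₀, Polynomial.map_prod]
      refine Finset.prod_congr rfl fun i _ => ?_
      simp only [β, GPoint.coord_map, GPoint.coord_ofNilpotent, Polynomial.map_sub,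
        Polynomial.map_X, Polynomial.map_C]
      rfl)
    rw [Polynomial.map_map, hl', hjl, ← Polynomial.map_map, ← hT U V j' α β, hj'] at h
    rw [hz, ← Polynomial.coeff_map, Polynomial.map_sub, h, sub_self, Polynomial.coeff_zero]
  -- Any other splitting is induced from the universal one.
  obtain ⟨ψ, hψ, hψa, hψb⟩ := huniv B φ.toRingHom _ _ ha hb
  let ψ' : U →ₐ[R] B := { ψ with
    commutes' := fun r => by
      show ψ (algebraMap A U (algebraMap R A r)) = _
      rw [← φ.commutes r]
      exact RingHom.congr_fun hψ (algebraMap R A r) }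
  have hψ' : ψ'.toRingHom = ψ := rfl
  rw [← hψ, ← Polynomial.map_map, key, ← hψ', hT U B ψ' α β]
  congr 1
  · funext i
    apply GPoint.coord_injective
    rw [GPoint.coord_map, GPoint.coord_ofNilpotent]
    exact hψa i
  · funext i
    apply GPoint.coord_injective
    rw [GPoint.coord_map, GPoint.coord_ofNilpotent]
    exact hψb i

variable (F) in
/-- The equation of the product of `∑ᵢ [aᵢ]` and `∑ⱼ [bⱼ]`. -/
def mulRule (d e : ℕ) : PointRule F d e := fun _ _ _ a b =>
  ∏ i, ∏ j, (Polynomial.X - Polynomial.C (a i + b j).coord)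

theorem isNatural_mulRule : (mulRule F d e).IsNatural := by
  intro B B' _ _ _ _ φ a b
  simp only [mulRule, Polynomial.map_prod, ← map_add, GPoint.coord_map]
  simp

theorem natDegree_prod_X_sub_C {B : Type u} [CommRing B] [Nontrivial B] {m : ℕ} (x : Fin m → B) :
    (∏ i, (Polynomial.X - Polynomial.C (x i))).natDegree = m := by
  rw [Polynomial.natDegree_prod_of_monic _ _ fun i _ => Polynomial.monic_X_sub_C _]
  simp

/-- For divisors of constant degree the numbers of points in the definition of the product are
determined, except over the zero ring, where there is nothing to check. -/
theorem isMul_iff_holds {D D' P : DivPlus A} (hD : IsDivisorOfDegree d D.eqn)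
    (hD' : IsDivisorOfDegree e D'.eqn) :
    DivPlus.IsMul F D D' P ↔ (mulRule F d e).Holds D.eqn D'.eqn P.eqn := by
  constructor
  · intro h B _ _ φ a b ha hb
    have := congrArg DivPlus.eqn (h B φ d e a b (DivPlus.eqn_injective (by simpa using ha))
      (DivPlus.eqn_injective (by simpa using hb)))
    simpa [mulRule] using this
  · intro h B _ _ φ d' e' a b ha hb
    apply DivPlus.eqn_injective
    rcases subsingleton_or_nontrivial B with hB | hB
    · exact Subsingleton.elim _ _
    have ha' := congrArg DivPlus.eqn ha
    have hb' := congrArg DivPlus.eqn hb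
    simp only [DivPlus.eqn_map, DivPlus.eqn_sum, GPoint.eqn_div] at ha' hb'
    obtain rfl : d' = d := by
      rw [← natDegree_prod_X_sub_C fun i => (a i).coord, ← ha', (hD.map _).natDegree]
    obtain rfl : e' = e := by
      rw [← natDegree_prod_X_sub_C fun i => (b i).coord, ← hb', (hD'.map _).natDegree]
    rw [DivPlus.eqn_map, h B φ a b ha' hb']
    simp [mulRule]

variable [F.IsComm]

variable (F) in
/-- The equation of `λʳ(∑ᵢ [aᵢ])`, as a construction that ignores its second argument, which is
the empty family. -/
def lamRule (r d : ℕ) : PointRule F d 0 := fun _ _ _ a _ =>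
  ∏ I ∈ Finset.powersetCard r (Finset.univ : Finset (Fin d)),
    (Polynomial.X - Polynomial.C (∑ i ∈ I, a i).coord)

theorem isNatural_lamRule (r : ℕ) : (lamRule F r d).IsNatural := by
  intro B B' _ _ _ _ φ a b
  simp only [lamRule, Polynomial.map_prod, ← map_sum, GPoint.coord_map]
  simp

theorem isLam_iff_holds (r : ℕ) {D P : DivPlus A} (hD : IsDivisorOfDegree d D.eqn) :
    DivPlus.IsLam F r D P ↔ (lamRule F r d).Holds D.eqn 1 P.eqn := by
  constructor
  · intro h B _ _ φ a b ha hb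
    have := congrArg DivPlus.eqn (h B φ d a (DivPlus.eqn_injective (by simpa using ha)))
    simpa [lamRule] using this
  · intro h B _ _ φ d' a ha
    apply DivPlus.eqn_injective
    rcases subsingleton_or_nontrivial B with hB | hB
    · exact Subsingleton.elim _ _
    have ha' := congrArg DivPlus.eqn ha
    simp only [DivPlus.eqn_map, DivPlus.eqn_sum, GPoint.eqn_div] at ha'
    obtain rfl : d' = d := by
      rw [← natDegree_prod_X_sub_C fun i => (a i).coord, ← ha', (hD.map _).natDegree]
    rw [DivPlus.eqn_map, h B φ a Fin.elim0 ha' (by simp)]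
    simp [lamRule]

/-- `X_Ch(G)` is a closed condition on functions from `R⁺(G)` to divisors of constant degree: it
can be checked on a jointly injective family of algebras. -/
theorem exists_xCh_of_jointly_injective {G : Type v} [Group G] (f : RepPlus G → DivPlus A)
    (hdeg : ∀ V, ∃ d, IsDivisorOfDegree d (f V).eqn)
    (hinj : ∀ x : A, (∀ (B : Type u) [CommRing B] [Algebra R B] (φ : A →ₐ[R] B) (g : XCh F B G),
      (∀ V, DivPlus.map φ.toRingHom (f V) = g.toFun V) → φ x = 0) → x = 0) :
    ∃ h : XCh F A G, h.toFun = f := by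
  have hD : ∀ {D D' : DivPlus A}, (∀ (B : Type u) [CommRing B] [Algebra R B] (φ : A →ₐ[R] B)
      (g : XCh F B G), (∀ V, DivPlus.map φ.toRingHom (f V) = g.toFun V) →
        DivPlus.map φ.toRingHom D = DivPlus.map φ.toRingHom D') → D = D' := by
    intro D D' h
    apply DivPlus.eqn_injective
    ext k
    rw [← sub_eq_zero]
    refine hinj _ fun B _ _ φ g hg => ?_
    have := congrArg (fun E => E.eqn.coeff k) (h B φ g hg)
    simp only [DivPlus.eqn_map, Polynomial.coeff_map] at this
    rw [map_sub, sub_eq_zero]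
    exact this
  refine ⟨⟨f, ?_, ?_, ?_, ?_, ?_⟩, rfl⟩
  · refine hD fun B _ _ φ g hg => ?_
    rw [hg, g.map_zero, map_zero]
  · refine hD fun B _ _ φ g hg => ?_
    rw [hg, g.map_one]
    apply DivPlus.eqn_injective
    simp [GPoint.coord_zero]
  · refine fun V W => hD fun B _ _ φ g hg => ?_
    rw [hg, g.map_add, map_add, hg, hg]
  · intro V W
    obtain ⟨d, hd⟩ := hdeg V
    obtain ⟨e, he⟩ := hdeg W
    rw [isMul_iff_holds hd he]
    refine PointRule.Holds.of_jointly_injective isNatural_mulRule hd he fun x hx => ?_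
    refine hinj x fun B _ _ φ g hg => hx B φ ?_
    have hd' : IsDivisorOfDegree d (g.toFun V).eqn := by
      rw [← hg]; exact hd.map _
    have he' : IsDivisorOfDegree e (g.toFun W).eqn := by
      rw [← hg]; exact he.map _
    have := (isMul_iff_holds hd' he').1 (g.map_mul V W)
    rwa [← hg, ← hg, ← hg] at this
  · intro r V
    obtain ⟨d, hd⟩ := hdeg V
    rw [isLam_iff_holds r hd]
    refine PointRule.Holds.of_jointly_injective (isNatural_lamRule r) hd isDivisorOfDegree_one
      fun x hx => ?_
    refine hinj x fun B _ _ φ g hg => hx B φ ?_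
    have hd' : IsDivisorOfDegree d (g.toFun V).eqn := by
      rw [← hg]; exact hd.map _
    have := (isLam_iff_holds r hd').1 (g.map_lam r V)
    rw [← hg, ← hg] at this
    rwa [Polynomial.map_one]

end SplitRules

/-! ### Degrees of the divisors attached to representations -/

section Degree

theorem IsDivisor.exists_eq_X_pow {K : Type u} [CommRing K] [IsDomain K] {f : K[X]}
    (hf : IsDivisor f) : ∃ d, f = Polynomial.X ^ d := by
  obtain ⟨N, e, d, he, h⟩ := hf
  obtain ⟨i, hi⟩ : ∃ i, e i ≠ 0 := by
    by_contra! hcon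
    have := he.complete
    simp [hcon] at this
  have hi1 : e i = 1 := (IsIdempotentElem.iff_eq_zero_or_one.1 (he.idem i)).resolve_left hi
  obtain ⟨g, hg, hfg⟩ := h i
  rw [hi1, Polynomial.C_1, one_mul, one_mul] at hfg
  refine ⟨d i, ?_⟩
  rw [hfg]
  ext k
  rw [Polynomial.coeff_X_pow]
  rcases lt_trichotomy k (d i) with hk | rfl | hk
  · rw [if_neg hk.ne, (hg.3 k hk).eq_zero]
  · rw [if_pos rfl, hg.1]
  · rw [if_neg hk.ne', hg.2 k hk]

/-- The degree of a divisor can be computed modulo all prime ideals. -/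
theorem IsDivisor.isDivisorOfDegree {A : Type u} [CommRing A] {f : A[X]} (hf : IsDivisor f)
    {d : ℕ} (h : ∀ q : Ideal A, q.IsPrime → f.map (Ideal.Quotient.mk q) = Polynomial.X ^ d) :
    IsDivisorOfDegree d f := by
  obtain ⟨N, e, deg, he, hloc⟩ := hf
  choose g hg hfg using hloc
  -- A nonzero idempotent survives modulo some prime, where it becomes `1`.
  have hdeg : ∀ i, e i ≠ 0 → deg i = d := by
    intro i hi
    obtain ⟨q, hq, hiq⟩ : ∃ q : Ideal A, q.IsPrime ∧ e i ∉ q := by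
      by_contra! hcon
      have hnil : IsNilpotent (e i) := nilpotent_iff_mem_prime.2 hcon
      obtain ⟨m, hm⟩ := hnil
      exact hi (by
        have := (he.idem i).pow_succ_eq m
        rw [← this, pow_succ, hm, zero_mul])
    have h1 : Ideal.Quotient.mk q (e i) = 1 :=
      (IsIdempotentElem.iff_eq_zero_or_one.1 ((he.idem i).map (Ideal.Quotient.mk q))).resolve_left
        fun h0 => hiq (Ideal.Quotient.eq_zero_iff_mem.1 h0)
    have h2 := congrArg (Polynomial.map (Ideal.Quotient.mk q)) (hfg i)
    rw [Polynomial.map_mul, Polynomial.map_mul, Polynomial.map_C, h1, Polynomial.C_1, one_mul,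
      one_mul, h q hq] at h2
    have h3 := ((hg i).map (Ideal.Quotient.mk q)).natDegree
    rw [← h2, Polynomial.natDegree_X_pow] at h3
    exact h3.symm
  have hcoeff : ∀ k, f.coeff k = ∑ i, e i * (g i).coeff k := by
    intro k
    rw [← one_mul (f.coeff k), ← he.complete, Finset.sum_mul]
    refine Finset.sum_congr rfl fun i _ => ?_
    simpa using congrArg (fun P => P.coeff k) (hfg i)
  refine ⟨?_, fun k hk => ?_, fun k hk => ?_⟩
  · rw [hcoeff, ← he.complete]
    refine Finset.sum_congr rfl fun i _ => ?_
    by_cases hi : e i = 0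
    · rw [hi, zero_mul]
    · rw [← hdeg i hi, (hg i).1, mul_one]
  · rw [hcoeff]
    refine Finset.sum_eq_zero fun i _ => ?_
    by_cases hi : e i = 0
    · rw [hi, zero_mul]
    · rw [(hg i).2 k (by rw [hdeg i hi]; exact hk), mul_zero]
  · rw [hcoeff]
    refine isNilpotent_sum fun i _ => ?_
    by_cases hi : e i = 0
    · rw [hi, zero_mul]
      exact IsNilpotent.zero
    · exact (Commute.all _ _).isNilpotent_mul_left ((hg i).3 k (by rw [hdeg i hi]; exact hk))

variable {R : Type u} [CommRing R] {F : FormalGroup R} [F.IsComm] {A : Type u} [CommRing A]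
  [Algebra R A] {G : Type v} [Group G] [Finite G]

/-- Over a domain, where every divisor is a multiple of `[0]`, the relations
`V ⊗ ρ ≅ ρ ^ (dim V)` and `ρ = 1 + W` for the regular representation `ρ` determine the degrees. -/
theorem XCh.eqn_eq_X_pow {K : Type u} [CommRing K] [IsDomain K] [Algebra R K] (f : XCh F K G)
    (V : FDRep.{0} ℂ G) :
    (f.toFun (RepPlus.mk V)).eqn = Polynomial.X ^ Module.finrank ℂ V := by
  let e := Finite.equivFin G
  obtain ⟨δ, hδ⟩ := (f.toFun (RepPlus.mk V)).isDivisor.exists_eq_X_pow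
  obtain ⟨ε, hε⟩ := (f.toFun (RepPlus.mk (regularRep e))).isDivisor.exists_eq_X_pow
  have hε0 : ε ≠ 0 := by
    -- The divisor of `ρ = 1 + W` has the summand `[0]`, so its equation is divisible by `t`.
    rintro rfl
    obtain ⟨W, hW⟩ := exists_mk_regularRep_eq e
    have h : (f.toFun (RepPlus.mk (regularRep e))).eqn = _ := congrArg DivPlus.eqn
      ((congrArg f.toFun hW).trans (f.map_add 1 W))
    rw [f.map_one, DivPlus.eqn_add, GPoint.eqn_div, GPoint.coord_zero,
      _root_.map_zero, sub_zero] at h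
    have h' := hε.symm.trans h
    have h0 := congrArg (fun P => P.coeff 0) h'
    simp at h0
  have hmul := f.map_mul (RepPlus.mk V) (RepPlus.mk (regularRep e)) K (AlgHom.id R K) δ ε
    (fun _ => 0) (fun _ => 0)
    (DivPlus.eqn_injective (by
      rw [DivPlus.eqn_map, hδ, DivPlus.eqn_sum]
      simp [GPoint.coord_zero]))
    (DivPlus.eqn_injective (by
      rw [DivPlus.eqn_map, hε, DivPlus.eqn_sum]
      simp [GPoint.coord_zero]))
  have hmul' := congrArg DivPlus.eqn hmul
  rw [DivPlus.eqn_map, mk_mul_regularRep, map_mk_translationRep e f.toFun f.map_zero f.map_add,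
    DivPlus.eqn_nsmul, hε] at hmul'
  have hdeg := congrArg Polynomial.natDegree hmul'
  simp [GPoint.coord_zero] at hdeg
  rw [hδ, hdeg.resolve_right hε0]

theorem XCh.isDivisorOfDegree (f : XCh F A G) (V : FDRep.{0} ℂ G) :
    IsDivisorOfDegree (Module.finrank ℂ V) (f.toFun (RepPlus.mk V)).eqn :=
  (f.toFun (RepPlus.mk V)).isDivisor.isDivisorOfDegree fun q _ =>
    (f.map (Ideal.Quotient.mkₐ R q)).eqn_eq_X_pow V

end Degree

/-! ### Uniform bounds for nilpotency -/

section NilpotencyBounds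

variable {A : Type u} [CommRing A]

theorem sum_pow_eq_zero {ι : Type*} (s : Finset ι) (y : ι → A) (d : ℕ)
    (hy : ∀ i ∈ s, y i ^ d = 0) : (∑ i ∈ s, y i) ^ (s.card * d + 1) = 0 := by
  classical
  induction s using Finset.induction_on with
  | empty => simp
  | insert i s hi ih =>
    rw [Finset.sum_insert hi, Finset.card_insert_of_notMem hi]
    refine (Commute.all _ _).add_pow_eq_zero_of_add_le_succ_of_pow_eq_zero
      (hy i (Finset.mem_insert_self i s))
      (ih fun j hj => hy j (Finset.mem_insert_of_mem hj)) ?_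
    rw [add_mul, one_mul]
    omega

theorem pow_eq_zero_of_mem_span_range {m d : ℕ} {y : Fin m → A} (hy : ∀ i, y i ^ d = 0) {z : A}
    (hz : z ∈ Ideal.span (Set.range y)) : z ^ (m * d + 1) = 0 := by
  obtain ⟨c, rfl⟩ := Ideal.mem_span_range_iff_exists_fun.1 hz
  have := sum_pow_eq_zero Finset.univ (fun i => c i * y i) d fun i _ => by
    rw [mul_pow, hy, mul_zero]
  rwa [Finset.card_univ, Fintype.card_fin] at this

/-- If `z` lies in all ideals `(x₀,σ(0), …, xₘ₋₁,σ(m-1))`, then a power of `z` lies in the ideal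
generated by the row products `∏ₗ xⱼₗ`. One row is treated at a time: the sets `T` in the proof are
the rows whose entries have been replaced by the product. -/
theorem pow_mem_span_prod_of_forall_mem_span {m : ℕ} (x : Fin m → Fin m → A) (z : A)
    (hz : ∀ σ : Fin m → Fin m, z ∈ Ideal.span (Set.range fun j => x j (σ j))) :
    z ^ m ^ m ∈ Ideal.span (Set.range fun j => ∏ l, x j l) := by
  classical
  have key : ∀ (T : Finset (Fin m)) (σ : Fin m → Fin m), z ^ m ^ T.card ∈
      Ideal.span (Set.range fun j => if j ∈ T then ∏ l, x j l else x j (σ j)) := by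
    intro T
    induction T using Finset.induction_on with
    | empty => simpa using hz
    | insert j₀ T hj₀ ih =>
      intro σ
      set K := Ideal.span (Set.range fun j => if j ∈ insert j₀ T then ∏ l, x j l else x j (σ j))
        with hK
      have hdvd : ∀ l, Ideal.Quotient.mk K (x j₀ l) ∣ Ideal.Quotient.mk K (z ^ m ^ T.card) := by
        intro l
        obtain ⟨c, hc⟩ := Ideal.mem_span_range_iff_exists_fun.1 (ih (Function.update σ j₀ l))
        rw [← hc, map_sum]
        refine Finset.dvd_sum fun j _ => ?_
        rw [map_mul]
        refine Dvd.dvd.mul_left ?_ _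
        by_cases hj : j = j₀
        · subst hj
          rw [if_neg hj₀, Function.update_self]
        · have hmem : (if j ∈ T then ∏ l, x j l else x j (Function.update σ j₀ l j)) ∈ K := by
            rw [Function.update_of_ne hj]
            refine Ideal.subset_span ⟨j, ?_⟩
            simp only [Finset.mem_insert, hj, false_or]
          rw [Ideal.Quotient.eq_zero_iff_mem.2 hmem]
          exact dvd_zero _
      have hprod := Finset.prod_dvd_prod_of_dvd (s := Finset.univ) _ _ fun l _ => hdvd l
      rw [Finset.prod_const, Finset.card_univ, Fintype.card_fin, ← map_prod, ← map_pow] at hprod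
      have hmem : ∏ l, x j₀ l ∈ K := Ideal.subset_span ⟨j₀, by simp⟩
      rw [Ideal.Quotient.eq_zero_iff_mem.2 hmem, zero_dvd_iff, Ideal.Quotient.eq_zero_iff_mem,
        ← pow_mul, ← pow_succ] at hprod
      rwa [Finset.card_insert_of_notMem hj₀]
  simpa using key Finset.univ id

theorem exists_iterate_eq_self {m : ℕ} (hm : m ≠ 0) (σ : Fin m → Fin m) :
    ∃ (j : Fin m) (c : ℕ), 0 < c ∧ c ≤ m ∧ σ^[c] j = j := by
  let j₀ : Fin m := ⟨0, Nat.pos_of_ne_zero hm⟩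
  obtain ⟨k, k', hne, h⟩ := Fintype.exists_ne_map_eq_of_card_lt
    (fun k : Fin (m + 1) => σ^[(k : ℕ)] j₀) (by simp)
  wlog hlt : k < k' generalizing k k'
  · exact this k' k hne.symm h.symm (lt_of_le_of_ne (not_lt.1 hlt) hne.symm)
  refine ⟨σ^[k] j₀, k' - k, Nat.sub_pos_of_lt hlt, by omega, ?_⟩
  rw [← Function.iterate_add_apply, Nat.sub_add_cancel hlt.le, ← h]

variable {R : Type u} [CommRing R] {F : FormalGroup R} [F.IsComm] [Algebra R A]

/-- If translation by `a` maps the set of the points `bⱼ` to itself up to nilpotents, then `a` is a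
torsion point up to nilpotents. Modulo the ideal identifying `a + bⱼ` with `b_σ(j)` for all `j`,
going once around a cycle of `σ` shows that a multiple of `a` vanishes. -/
theorem coord_factorial_nsmul_pow_eq_zero {m d : ℕ} (hm : m ≠ 0) (a : GPoint F A)
    (b : Fin m → GPoint F A)
    (h : ∀ j, (∏ l, ((a + b j).coord - (b l).coord)) ^ d = 0) :
    (m.factorial • a).coord ^ (m ^ m * (m * d + 1)) = 0 := by
  rw [pow_mul]
  refine pow_eq_zero_of_mem_span_range h ?_
  refine pow_mem_span_prod_of_forall_mem_span (fun j l => (a + b j).coord - (b l).coord) _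
    fun σ => ?_
  set Q := Ideal.span (Set.range fun j => (a + b j).coord - (b (σ j)).coord) with hQ
  let π := Ideal.Quotient.mkₐ R Q
  have hstep : ∀ j, GPoint.map π (b j) + GPoint.map π a = GPoint.map π (b (σ j)) := by
    intro j
    apply GPoint.coord_injective
    rw [add_comm, ← map_add, GPoint.coord_map, GPoint.coord_map]
    exact Ideal.Quotient.eq.2 (Ideal.subset_span ⟨j, rfl⟩)
  have hiter : ∀ (c : ℕ) j, GPoint.map π (b j) + c • GPoint.map π a =
      GPoint.map π (b (σ^[c] j)) := by
    intro c
    induction c with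
    | zero => intro j; simp
    | succ c ih =>
      intro j
      rw [succ_nsmul, ← add_assoc, ih, hstep, Function.iterate_succ_apply']
  obtain ⟨j, c, hc, hcm, hj⟩ := exists_iterate_eq_self hm σ
  have h0 : c • GPoint.map π a = 0 := eq_zero_of_add_eq_self ((hiter c j).trans (by rw [hj]))
  obtain ⟨q, hq⟩ := Nat.dvd_factorial hc hcm
  have h1 : GPoint.map π (m.factorial • a) = 0 := by
    rw [map_nsmul, hq, mul_nsmul, h0, nsmul_zero]
  have h2 := congrArg GPoint.coord h1
  rw [GPoint.coord_map, GPoint.coord_zero] at h2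
  exact Ideal.Quotient.eq_zero_iff_mem.1 h2

/-- Any two divisors of constant degree become sums of points over some extension ring. -/
theorem exists_split_by_points (F : FormalGroup R) {d e : ℕ} [Nontrivial A] {f g : A[X]}
    (hf : IsDivisorOfDegree d f) (hg : IsDivisorOfDegree e g) :
    ∃ (U : Type u) (_ : CommRing U) (_ : Algebra R U) (ι : A →ₐ[R] U) (a : Fin d → GPoint F U)
      (b : Fin e → GPoint F U), Function.Injective ι ∧
        f.map ι.toRingHom = ∏ i, (Polynomial.X - Polynomial.C (a i).coord) ∧
        g.map ι.toRingHom = ∏ i, (Polynomial.X - Polynomial.C (b i).coord) := by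
  obtain ⟨U, _, _, _, _, a₀, b₀, ha₀, hb₀, -⟩ := exists_universal_splitting_pair f g
    hf.monic hf.natDegree hg.monic hg.natDegree
  let _ : Algebra R U := ((algebraMap A U).comp (algebraMap R A)).toAlgebra
  let ι : A →ₐ[R] U := { algebraMap A U with commutes' := fun _ => rfl }
  have hna := (hf.map (algebraMap A U)).isNilpotent_of_eq_prod ha₀
  have hnb := (hg.map (algebraMap A U)).isNilpotent_of_eq_prod hb₀
  refine ⟨U, inferInstance, inferInstance, ι, fun i => GPoint.ofNilpotent F (hna i),
    fun i => GPoint.ofNilpotent F (hnb i), FaithfulSMul.algebraMap_injective A U, ?_, ?_⟩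
  · simpa using! ha₀
  · simpa using! hb₀

theorem coeff_prod_mem_span {d k : ℕ} (hk : k < d) (x : Fin d → A) :
    (∏ i, (Polynomial.X - Polynomial.C (x i))).coeff k ∈ Ideal.span (Set.range x) := by
  rw [← Ideal.Quotient.eq_zero_iff_mem, ← Polynomial.coeff_map, Polynomial.map_prod]
  have : ∀ i, (Polynomial.X - Polynomial.C (x i)).map
      (Ideal.Quotient.mk (Ideal.span (Set.range x))) = Polynomial.X := fun i => by
    have hi : x i ∈ Ideal.span (Set.range x) := Ideal.subset_span ⟨i, rfl⟩
    rw [Polynomial.map_sub, Polynomial.map_X, Polynomial.map_C,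
      Ideal.Quotient.eq_zero_iff_mem.2 hi, map_zero, sub_zero]
  simp only [this, Finset.prod_const, Finset.card_univ, Fintype.card_fin, Polynomial.coeff_X_pow,
    if_neg hk.ne]

/-- For points of `X_Ch(G)` over algebras over the residue field, the lower coefficients of the
divisor of `V` are nilpotent of bounded order. With `f(V) = ∑ᵢ [aᵢ]` and `f(ρ) = ∑ⱼ [bⱼ]`, where `ρ`
is the regular representation, the relation `V ⊗ ρ ≅ ρ ^ (dim V)` says that
`∏ᵢⱼ (t - x(aᵢ + bⱼ)) = ∏ⱼ (t - x(bⱼ)) ^ (dim V)`, so that translation by `aᵢ` maps the set of the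
`bⱼ` to itself up to nilpotents. -/
theorem exists_coeff_pow_eq_zero [IsLocalRing R] {p n : ℕ} (hp : p.Prime)
    (hlocal : ∀ q : ℕ, q.Prime → q ≠ p → IsUnit (q : R)) (hF : ReductionHasHeight F p n)
    {G : Type v} [Group G] [Finite G] (V : FDRep.{0} ℂ G) :
    ∃ M : ℕ, ∀ (A : Type u) [CommRing A] [Algebra R A],
      IsLocalRing.maximalIdeal R ≤ RingHom.ker (algebraMap R A) → ∀ f : XCh F A G,
        ∀ k < Module.finrank ℂ V, (f.toFun (RepPlus.mk V)).eqn.coeff k ^ M = 0 := by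
  let e := Finite.equivFin G
  set m := Module.finrank ℂ (regularRep e) with hm
  have hm0 : m ≠ 0 := by
    have : m = Nat.card G := (Module.finrank_fintype_fun_eq_card ℂ).trans (Fintype.card_fin _)
    rw [this]
    exact Nat.card_pos.ne'
  set d := Module.finrank ℂ V with hd
  obtain ⟨h, hh⟩ := exists_coord_nsmul_eq (F := F) hp hlocal hF m.factorial
    (Nat.factorial_ne_zero m)
  refine ⟨d * (h * (m ^ m * (m * d + 1))) + 1, fun A _ _ hA f k hk => ?_⟩
  rcases subsingleton_or_nontrivial A with hsub | hnt
  · exact Subsingleton.elim _ _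
  have hfV := f.isDivisorOfDegree V
  have hfρ := f.isDivisorOfDegree (regularRep e)
  obtain ⟨U, _, _, ι, a, b, hι, ha, hb⟩ := exists_split_by_points F hfV hfρ
  have hU : IsLocalRing.maximalIdeal R ≤ RingHom.ker (algebraMap R U) := fun r hr => by
    rw [RingHom.mem_ker, ← ι.commutes, (hA hr : algebraMap R A r = 0), map_zero]
  have hmul := (isMul_iff_holds hfV hfρ).1 (f.map_mul _ _) U ι a b ha hb
  rw [mk_mul_regularRep, map_mk_translationRep e f.toFun f.map_zero f.map_add, DivPlus.eqn_nsmul,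
    Polynomial.map_pow, hb] at hmul
  have hna : ∀ i, (a i).coord ^ (h * (m ^ m * (m * d + 1))) = 0 := by
    intro i
    have h0 := coord_factorial_nsmul_pow_eq_zero (d := d) hm0 (a i) b fun j => by
      have := congrArg (Polynomial.eval (a i + b j).coord) hmul
      rw [Polynomial.eval_pow, Polynomial.eval_prod] at this
      simp only [Polynomial.eval_sub, Polynomial.eval_X, Polynomial.eval_C] at this
      refine this.trans ?_
      rw [mulRule, Polynomial.eval_prod]
      refine Finset.prod_eq_zero (Finset.mem_univ i) ?_
      rw [Polynomial.eval_prod]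
      exact Finset.prod_eq_zero (Finset.mem_univ j) (by simp)
    obtain ⟨w, hw, hwa⟩ := hh U hU (a i)
    rw [hwa, mul_pow, ← pow_mul] at h0
    exact ((hw.pow _).mul_right_eq_zero).1 h0
  apply hι
  rw [map_pow, map_zero]
  have hc : ι ((f.toFun (RepPlus.mk V)).eqn.coeff k) =
      (∏ i, (Polynomial.X - Polynomial.C (a i).coord)).coeff k := by
    rw [← ha, Polynomial.coeff_map]
    rfl
  rw [hc]
  exact pow_eq_zero_of_mem_span_range hna (coeff_prod_mem_span hk _)

end NilpotencyBounds

/-! ### Representability of a closed subfunctor of affine space -/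

section Limits

/-- Convergence of Cauchy sequences in a finite free module, coordinate by coordinate. -/
theorem exists_limit_pi {R : Type*} [CommRing R] (I : Ideal R) [IsPrecomplete I R] {κ : Type*}
    (t : ℕ → κ → R) (h : ∀ k e, t (k + 1) e - t k e ∈ I ^ k) :
    ∃ L : κ → R, ∀ k e, L e - t k e ∈ I ^ k := by
  have key : ∀ e, ∃ L : R, ∀ k, L - t k e ∈ I ^ k := by
    intro e
    have hmn : ∀ m j, t (m + j) e - t m e ∈ I ^ m := by
      intro m j
      induction j with
      | zero => simp
      | succ j ih =>
        have := add_mem (Ideal.pow_le_pow_right (Nat.le_add_right m j) (h (m + j) e)) ih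
        rwa [sub_add_sub_cancel] at this
    obtain ⟨L, hL⟩ := IsPrecomplete.prec (I := I) (M := R) inferInstance (f := fun k => t k e)
      (by
        intro m n hmn'
        obtain ⟨j, rfl⟩ := Nat.exists_eq_add_of_le hmn'
        rw [smul_eq_mul, Ideal.mul_top]
        exact (SModEq.sub_mem.2 (hmn m j)).symm)
    refine ⟨L, fun k => ?_⟩
    have := hL k
    rw [smul_eq_mul, Ideal.mul_top] at this
    exact SModEq.sub_mem.1 this.symm
  choose L hL using key
  exact ⟨L, fun k e => hL e k⟩

end Limits

section Representability

variable {R : Type u} [CommRing R] [IsLocalRing R]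

/-- A finite system of coordinates embedding `X_Ch(G)` as a closed subscheme of an affine space, in
which the coordinates of points over algebras over the residue field are nilpotent of bounded
order. -/
structure CoordinateSystem (F : FormalGroup R) [F.IsComm] (G : Type v) [Group G] (ι : Type) where
  coord : ∀ (A : Type u) [CommRing A] [Algebra R A], XCh F A G → ι → A
  coord_map : ∀ (A B : Type u) [CommRing A] [Algebra R A] [CommRing B] [Algebra R B]
    (φ : A →ₐ[R] B) (f : XCh F A G) (i : ι), coord B (f.map φ) i = φ (coord A f i)
  coord_injective : ∀ (A : Type u) [CommRing A] [Algebra R A], Function.Injective (coord A)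
  /-- The common bound for the order of nilpotency. -/
  bound : ℕ
  coord_pow_bound : ∀ (A : Type u) [CommRing A] [Algebra R A],
    IsLocalRing.maximalIdeal R ≤ RingHom.ker (algebraMap R A) → ∀ (f : XCh F A G) (i : ι),
      coord A f i ^ bound = 0
  /-- A nilpotent family is the family of coordinates of a point as soon as it becomes one over a
  jointly injective family of algebras. -/
  exists_point : ∀ (A : Type u) [CommRing A] [Algebra R A] (y : ι → A), (∀ i, IsNilpotent (y i)) →
    (∀ z : A, (∀ (B : Type u) [CommRing B] [Algebra R B] (φ : A →ₐ[R] B) (g : XCh F B G),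
      (∀ i, φ (y i) = coord B g i) → φ z = 0) → z = 0) → ∃ f : XCh F A G, coord A f = y

namespace CoordinateSystem

variable {F : FormalGroup R} [F.IsComm] {G : Type v} [Group G] {ι : Type}
  (S : CoordinateSystem F G ι)

open IsLocalRing MvPolynomial

/-- The polynomials vanishing at all points over algebras killed by `𝔪 ^ k`. -/
def levelIdeal (k : ℕ) : Ideal (MvPolynomial ι R) where
  carrier := {p | ∀ (A : Type u) [CommRing A] [Algebra R A],
    maximalIdeal R ^ k ≤ RingHom.ker (algebraMap R A) → ∀ f : XCh F A G,
      aeval (S.coord A f) p = 0}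
  add_mem' hp hq A _ _ hA f := by rw [_root_.map_add, hp A hA f, hq A hA f, add_zero]
  zero_mem' A _ _ _ f := _root_.map_zero _
  smul_mem' c p hp A _ _ hA f := by rw [smul_eq_mul, _root_.map_mul, hp A hA f, mul_zero]

theorem map_pow_le_levelIdeal (k : ℕ) :
    (maximalIdeal R ^ k).map (algebraMap R (MvPolynomial ι R)) ≤ S.levelIdeal k := by
  rw [Ideal.map_le_iff_le_comap]
  intro r hr A _ _ hA f
  rw [AlgHom.commutes]
  exact hA hr

theorem coord_pow_eq_zero {k : ℕ} {A : Type u} [CommRing A] [Algebra R A]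
    (hA : maximalIdeal R ^ k ≤ RingHom.ker (algebraMap R A)) (f : XCh F A G) (i : ι) :
    S.coord A f i ^ (S.bound * k) = 0 := by
  set J := (maximalIdeal R).map (algebraMap R A) with hJ
  have h1 : S.coord A f i ^ S.bound ∈ J := by
    have h := S.coord_pow_bound (A ⧸ J) (fun r hr => by
      rw [RingHom.mem_ker, IsScalarTower.algebraMap_apply R A (A ⧸ J)]
      exact Ideal.Quotient.eq_zero_iff_mem.2 (Ideal.mem_map_of_mem _ hr))
      (f.map (Ideal.Quotient.mkₐ R J)) i
    rw [S.coord_map, ← _root_.map_pow] at h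
    exact Ideal.Quotient.eq_zero_iff_mem.1 h
  have h2 : J ^ k = ⊥ := by
    rw [hJ, ← Ideal.map_pow, eq_bot_iff, Ideal.map_le_iff_le_comap]
    intro r hr
    exact hA hr
  have h3 := Ideal.pow_mem_pow h1 k
  rw [h2, Ideal.mem_bot, ← pow_mul] at h3
  exact h3

/-- The algebra representing the points over algebras killed by `𝔪 ^ k`. -/
abbrev LevelRing (k : ℕ) : Type u := MvPolynomial ι R ⧸ S.levelIdeal k

theorem pow_le_ker_levelRing (k : ℕ) :
    maximalIdeal R ^ k ≤ RingHom.ker (algebraMap R (S.LevelRing k)) := fun r hr => by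
  rw [RingHom.mem_ker, IsScalarTower.algebraMap_apply R (MvPolynomial ι R) (S.LevelRing k)]
  exact Ideal.Quotient.eq_zero_iff_mem.2
    (S.map_pow_le_levelIdeal k (Ideal.mem_map_of_mem _ hr))

/-- The map out of the representing algebra that classifies a point. -/
def classify {k : ℕ} {A : Type u} [CommRing A] [Algebra R A]
    (hA : maximalIdeal R ^ k ≤ RingHom.ker (algebraMap R A)) (f : XCh F A G) :
    S.LevelRing k →ₐ[R] A :=
  Ideal.Quotient.liftₐ (S.levelIdeal k) (aeval (S.coord A f)) fun _ hp => hp A hA f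

theorem classify_mk {k : ℕ} {A : Type u} [CommRing A] [Algebra R A]
    (hA : maximalIdeal R ^ k ≤ RingHom.ker (algebraMap R A)) (f : XCh F A G)
    (p : MvPolynomial ι R) :
    S.classify hA f (Ideal.Quotient.mk _ p) = aeval (S.coord A f) p :=
  Ideal.Quotient.liftₐ_apply _ _ _ _

/-- The algebra of level `k` embeds into the product of all algebras with a point of level `k`, so
its tautological family of coordinates belongs to a point. -/
theorem exists_univPoint (k : ℕ) : ∃ f : XCh F (S.LevelRing k) G,
    S.coord _ f = fun i => Ideal.Quotient.mk (S.levelIdeal k) (X i) := by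
  refine S.exists_point _ _ (fun i => ⟨S.bound * k, ?_⟩) fun z hz => ?_
  · rw [← _root_.map_pow]
    refine Ideal.Quotient.eq_zero_iff_mem.2 fun A _ _ hA f => ?_
    rw [_root_.map_pow, aeval_X, S.coord_pow_eq_zero hA]
  · obtain ⟨p, rfl⟩ := Ideal.Quotient.mk_surjective z
    refine Ideal.Quotient.eq_zero_iff_mem.2 fun A _ _ hA f => ?_
    rw [← S.classify_mk hA]
    refine hz A (S.classify hA f) f fun i => ?_
    rw [classify_mk, aeval_X]

/-- The universal point over algebras killed by `𝔪 ^ k`. -/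
def univPoint (k : ℕ) : XCh F (S.LevelRing k) G := (S.exists_univPoint k).choose

theorem coord_univPoint (k : ℕ) :
    S.coord _ (S.univPoint k) = fun i => Ideal.Quotient.mk (S.levelIdeal k) (X i) :=
  (S.exists_univPoint k).choose_spec

theorem map_classify {k : ℕ} {A : Type u} [CommRing A] [Algebra R A]
    (hA : maximalIdeal R ^ k ≤ RingHom.ker (algebraMap R A)) (f : XCh F A G) :
    (S.univPoint k).map (S.classify hA f) = f := by
  apply S.coord_injective
  funext i
  rw [S.coord_map, coord_univPoint, classify_mk, aeval_X]

/-- The universal point over the algebra of level `k` restricts to a point over its quotient by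
`𝔪 ^ k'`, where the polynomials in the ideal of level `k'` vanish. -/
theorem levelIdeal_le_sup (k k' : ℕ) : S.levelIdeal k' ≤
    S.levelIdeal k ⊔ (maximalIdeal R ^ k').map (algebraMap R (MvPolynomial ι R)) := by
  intro p hp
  set J := S.levelIdeal k ⊔ (maximalIdeal R ^ k').map (algebraMap R (MvPolynomial ι R)) with hJ
  let π : S.LevelRing k →ₐ[R] MvPolynomial ι R ⧸ J :=
    Ideal.Quotient.factorₐ R (le_sup_left : S.levelIdeal k ≤ J)
  have h := hp (MvPolynomial ι R ⧸ J) (fun r hr => by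
    rw [RingHom.mem_ker, IsScalarTower.algebraMap_apply R (MvPolynomial ι R)]
    exact Ideal.Quotient.eq_zero_iff_mem.2
      ((le_sup_right : _ ≤ J) (Ideal.mem_map_of_mem _ hr))) ((S.univPoint k).map π)
  have hc : S.coord _ ((S.univPoint k).map π) = fun i => Ideal.Quotient.mkₐ R J (X i) := by
    funext i
    rw [S.coord_map, coord_univPoint]
    rfl
  have ha : aeval (fun i => Ideal.Quotient.mkₐ R J (X i)) = Ideal.Quotient.mkₐ R J :=
    MvPolynomial.algHom_ext fun i => by rw [aeval_X]
  rw [hc, ha] at h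
  exact Ideal.Quotient.eq_zero_iff_mem.1 h

/-- The coordinates as natural transformations. -/
def coordFunction (i : ι) : chernRing F G :=
  ⟨fun A f => S.coord A.1 f i, fun A A' φ f => S.coord_map A.1 A'.1 φ f i⟩

/-- The natural transformations given by polynomials in the coordinates. -/
def evalPoly : MvPolynomial ι R →ₐ[R] chernRing F G :=
  aeval S.coordFunction

theorem evalPoly_apply (p : MvPolynomial ι R) (A : DiscreteAlg R) (f : XCh F A.1 G) :
    (S.evalPoly p).1 A f = aeval (S.coord A.1 f) p := by
  have : (evalPoint F G A f).comp S.evalPoly = aeval (S.coord A.1 f) :=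
    MvPolynomial.algHom_ext fun i => by
      rw [AlgHom.comp_apply, evalPoly, aeval_X, aeval_X]
      rfl
  exact DFunLike.congr_fun this p

/-- A natural transformation vanishes to level `k` if it does so at the points over the algebras
killed by `𝔪 ^ k`. -/
def VanishesAt (s : chernRing F G) (k : ℕ) : Prop :=
  ∀ A : DiscreteAlg R, maximalIdeal R ^ k ≤ RingHom.ker (algebraMap R A.1) →
    ∀ f : XCh F A.1 G, s.1 A f = 0

theorem vanishesAt_evalPoly {p : MvPolynomial ι R} {k : ℕ} (hp : p ∈ S.levelIdeal k) :
    VanishesAt (S.evalPoly p) k := fun A hA f => by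
  rw [evalPoly_apply]
  exact hp A.1 hA f

theorem mem_levelIdeal_of_vanishesAt {p : MvPolynomial ι R} {k : ℕ}
    (hp : VanishesAt (S.evalPoly p) k) : p ∈ S.levelIdeal k := fun A _ _ hA f => by
  have := hp ⟨CommAlgCat.of R A, k, hA⟩ hA f
  rwa [evalPoly_apply] at this

theorem VanishesAt.add {s t : chernRing F G} {k : ℕ} (hs : VanishesAt s k) (ht : VanishesAt t k) :
    VanishesAt (s + t) k := fun A hA f => by
  show s.1 A f + t.1 A f = 0
  rw [hs A hA f, ht A hA f, add_zero]

theorem VanishesAt.neg {s : chernRing F G} {k : ℕ} (hs : VanishesAt s k) :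
    VanishesAt (-s) k := fun A hA f => by
  show -(s.1 A f) = 0
  rw [hs A hA f, neg_zero]

theorem VanishesAt.of_le {s : chernRing F G} {k k' : ℕ} (hs : VanishesAt s k') (h : k ≤ k') :
    VanishesAt s k := fun A hA f => hs A ((Ideal.pow_le_pow_right h).trans hA) f

theorem eq_zero_of_forall_vanishesAt {s : chernRing F G} (hs : ∀ k, VanishesAt s k) : s = 0 := by
  apply Subtype.ext
  funext A f
  obtain ⟨k, hk⟩ := A.2
  exact hs k A hk f

/-- At a fixed level a natural transformation is given by its value at the universal point. -/
theorem exists_vanishesAt_sub (s : chernRing F G) (k : ℕ) :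
    ∃ p, VanishesAt (s - S.evalPoly p) k := by
  let Q : DiscreteAlg R := ⟨CommAlgCat.of R (S.LevelRing k), k, S.pow_le_ker_levelRing k⟩
  obtain ⟨p, hp⟩ := Ideal.Quotient.mk_surjective (I := S.levelIdeal k) (s.1 Q (S.univPoint k))
  refine ⟨p, fun A hA f => ?_⟩
  show s.1 A f - (S.evalPoly p).1 A f = 0
  have h := s.2 Q A (S.classify hA f) (S.univPoint k)
  rw [S.map_classify hA f, ← hp] at h
  rw [evalPoly_apply, h, sub_eq_zero]
  exact S.classify_mk hA f p

variable [Fintype ι] [DecidableEq ι]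

/-- The polynomial with given coefficients in which all exponents are less than the common bound
for the order of nilpotency. -/
def boundedPoly : ((ι → Fin S.bound) → R) →ₗ[R] MvPolynomial ι R :=
  Fintype.linearCombination R fun e : ι → Fin S.bound => ∏ i, X i ^ (e i : ℕ)

theorem boundedPoly_apply (t : (ι → Fin S.bound) → R) :
    S.boundedPoly t = ∑ e, t e • ∏ i, X i ^ (e i : ℕ) := rfl

theorem boundedPoly_mem {k : ℕ} {t : (ι → Fin S.bound) → R}
    (ht : ∀ e, t e ∈ maximalIdeal R ^ k) : S.boundedPoly t ∈ S.levelIdeal k := by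
  rw [boundedPoly_apply]
  refine sum_mem fun e _ => ?_
  rw [Algebra.smul_def]
  exact Ideal.mul_mem_right _ _ (S.map_pow_le_levelIdeal k (Ideal.mem_map_of_mem _ (ht e)))

/-- The other monomials vanish at all points over algebras over the residue field. -/
theorem exists_boundedPoly_level_one (p : MvPolynomial ι R) :
    ∃ t, p - S.boundedPoly t ∈ S.levelIdeal 1 := by
  induction p using MvPolynomial.induction_on' with
  | monomial s r =>
    by_cases hs : ∀ i, s i < S.bound
    · refine ⟨Pi.single (fun i => ⟨s i, hs i⟩) r, ?_⟩
      have : S.boundedPoly (Pi.single (fun i => ⟨s i, hs i⟩) r) = monomial s r := by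
        rw [boundedPoly_apply, Finset.sum_eq_single (fun i => ⟨s i, hs i⟩)]
        · rw [Pi.single_eq_same, monomial_eq, smul_eq_C_mul, Finsupp.prod_fintype]
          exact fun i => pow_zero _
        · intro e _ he
          rw [Pi.single_eq_of_ne he, zero_smul]
        · simp
      rw [this, sub_self]
      exact zero_mem _
    · push Not at hs
      obtain ⟨i, hi⟩ := hs
      refine ⟨0, ?_⟩
      rw [_root_.map_zero, sub_zero]
      intro A _ _ hA f
      rw [aeval_monomial, Finsupp.prod_fintype _ _ fun _ => pow_zero _,
        Finset.prod_eq_zero (Finset.mem_univ i), mul_zero]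
      exact pow_eq_zero_of_le hi (S.coord_pow_bound A (by rwa [pow_one] at hA) f i)
  | add p q hp hq =>
    obtain ⟨t, ht⟩ := hp
    obtain ⟨t', ht'⟩ := hq
    refine ⟨t + t', ?_⟩
    rw [_root_.map_add, add_sub_add_comm]
    exact add_mem ht ht'

/-- Nakayama's lemma, in its nilpotent form, for the algebra of level `k`. -/
theorem range_boundedPoly_sup_eq_top (k : ℕ) :
    LinearMap.range S.boundedPoly ⊔ (S.levelIdeal k).restrictScalars R = ⊤ := by
  set N := LinearMap.range S.boundedPoly ⊔ (S.levelIdeal k).restrictScalars R with hN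
  have h1 : N ⊔ maximalIdeal R • (⊤ : Submodule R (MvPolynomial ι R)) = ⊤ := by
    rw [eq_top_iff]
    intro p _
    obtain ⟨t, ht⟩ := S.exists_boundedPoly_level_one p
    have h := S.levelIdeal_le_sup k 1 ht
    rw [pow_one] at h
    obtain ⟨q, hq, y, hy, hqy⟩ := Submodule.mem_sup.1 h
    have hp : p = (S.boundedPoly t + q) + y := by rw [add_assoc, hqy, add_sub_cancel]
    rw [hp]
    refine Submodule.add_mem_sup (Submodule.add_mem_sup ⟨t, rfl⟩ hq) ?_
    rw [Ideal.smul_top_eq_map]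
    exact hy
  have h2 : ∀ j : ℕ, N ⊔ maximalIdeal R ^ j • (⊤ : Submodule R (MvPolynomial ι R)) = ⊤ := by
    intro j
    induction j with
    | zero => rw [pow_zero, Ideal.one_eq_top, Submodule.top_smul, sup_top_eq]
    | succ j ih =>
      rw [eq_top_iff]
      calc ⊤ = N ⊔ maximalIdeal R ^ j • (N ⊔ maximalIdeal R • (⊤ : Submodule R _)) := by
            rw [h1, ih]
        _ ≤ N ⊔ maximalIdeal R ^ (j + 1) • (⊤ : Submodule R _) := by
            rw [Submodule.smul_sup, ← Submodule.mul_smul, ← pow_succ]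
            exact sup_le le_sup_left (sup_le (Submodule.smul_le_right.trans le_sup_left)
              le_sup_right)
  have h3 := h2 k
  rw [sup_eq_left.2] at h3
  · exact h3
  · rw [Ideal.smul_top_eq_map]
    exact le_sup_of_le_right (S.map_pow_le_levelIdeal k)

theorem exists_boundedPoly (k : ℕ) (p : MvPolynomial ι R) :
    ∃ t, p - S.boundedPoly t ∈ S.levelIdeal k := by
  have hp : p ∈ LinearMap.range S.boundedPoly ⊔ (S.levelIdeal k).restrictScalars R := by
    rw [range_boundedPoly_sup_eq_top]
    trivial
  obtain ⟨_, ⟨t, rfl⟩, q, hq, rfl⟩ := Submodule.mem_sup.1 hp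
  exact ⟨t, by rw [add_sub_cancel_left]; exact hq⟩

/-- If a combination of the bounded monomials vanishes to level `k`, then it is possible to change
its coefficients by elements of `𝔪 ^ k` so that it vanishes to level `k + 1`. -/
theorem exists_boundedPoly_sub_mem (k : ℕ) (z : (ι → Fin S.bound) → R)
    (hz : S.boundedPoly z ∈ S.levelIdeal k) :
    ∃ y : (ι → Fin S.bound) → R, (∀ e, y e ∈ maximalIdeal R ^ k) ∧
      S.boundedPoly (z - y) ∈ S.levelIdeal (k + 1) := by
  obtain ⟨q, hq, w, hw, hqw⟩ := Submodule.mem_sup.1 (S.levelIdeal_le_sup (k + 1) k hz)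
  have hw' : w ∈ maximalIdeal R ^ k • (⊤ : Submodule R (MvPolynomial ι R)) := by
    rw [Ideal.smul_top_eq_map]
    exact hw
  rw [← S.range_boundedPoly_sup_eq_top (k + 1), Submodule.smul_sup, LinearMap.range_eq_map,
    ← Submodule.map_smul''] at hw'
  obtain ⟨_, ⟨y, hy, rfl⟩, q', hq', rfl⟩ := Submodule.mem_sup.1 hw'
  refine ⟨y, fun e => ?_, ?_⟩
  · refine Submodule.smul_induction_on hy (fun r hr t _ => ?_) fun t t' ht ht' => add_mem ht ht'
    exact Ideal.mul_mem_right _ _ hr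
  · rw [map_sub, ← hqw, show q + (S.boundedPoly y + q') - S.boundedPoly y = q + q' by ring]
    have hq'' : q' ∈ (S.levelIdeal (k + 1)).restrictScalars R := Submodule.smul_le_right hq'
    exact Ideal.add_mem _ hq hq''

/-- An approximation of a natural transformation to level `k₀` can be corrected by coefficients in
`𝔪 ^ k₀` to give it exactly. -/
theorem exists_evalPoly_boundedPoly_eq [IsPrecomplete (maximalIdeal R) R] (s : chernRing F G)
    (k₀ : ℕ) (t₀ : (ι → Fin S.bound) → R)
    (h₀ : VanishesAt (s - S.evalPoly (S.boundedPoly t₀)) k₀) :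
    ∃ t : (ι → Fin S.bound) → R, (∀ e, t e - t₀ e ∈ maximalIdeal R ^ k₀) ∧
      S.evalPoly (S.boundedPoly t) = s := by
  have step : ∀ k (t : (ι → Fin S.bound) → R),
      VanishesAt (s - S.evalPoly (S.boundedPoly t)) k → ∃ t' : (ι → Fin S.bound) → R,
        (∀ e, t' e - t e ∈ maximalIdeal R ^ k) ∧
          VanishesAt (s - S.evalPoly (S.boundedPoly t')) (k + 1) := by
    intro k t ht
    obtain ⟨p, hp⟩ := S.exists_vanishesAt_sub s (k + 1)
    obtain ⟨t', ht'⟩ := S.exists_boundedPoly (k + 1) p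
    have hs' : VanishesAt (s - S.evalPoly (S.boundedPoly t')) (k + 1) := by
      have := hp.add (S.vanishesAt_evalPoly ht')
      rwa [_root_.map_sub, sub_add_sub_cancel] at this
    have hd : S.boundedPoly (t' - t) ∈ S.levelIdeal k := by
      apply S.mem_levelIdeal_of_vanishesAt
      have := ht.add (hs'.of_le (Nat.le_succ k)).neg
      rwa [_root_.map_sub, _root_.map_sub,
        show S.evalPoly (S.boundedPoly t') - S.evalPoly (S.boundedPoly t) =
          s - S.evalPoly (S.boundedPoly t) + -(s - S.evalPoly (S.boundedPoly t')) by abel]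
    obtain ⟨y, hy, hyd⟩ := S.exists_boundedPoly_sub_mem k _ hd
    refine ⟨t + y, fun e => by simpa using hy e, ?_⟩
    have := hs'.add (S.vanishesAt_evalPoly hyd)
    rwa [show s - S.evalPoly (S.boundedPoly t') + S.evalPoly (S.boundedPoly (t' - t - y)) =
      s - S.evalPoly (S.boundedPoly (t + y)) by
        simp only [_root_.map_sub, _root_.map_add]; abel] at this
  choose! next hnext hnext' using step
  obtain ⟨seq, hseq₀, hseqv, hseq⟩ : ∃ seq : ℕ → (ι → Fin S.bound) → R, seq 0 = t₀ ∧
      (∀ j, VanishesAt (s - S.evalPoly (S.boundedPoly (seq j))) (k₀ + j)) ∧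
        ∀ j e, seq (j + 1) e - seq j e ∈ maximalIdeal R ^ (k₀ + j) := by
    let seq : ℕ → (ι → Fin S.bound) → R := fun j => Nat.rec t₀ (fun j t => next (k₀ + j) t) j
    have hv : ∀ j, VanishesAt (s - S.evalPoly (S.boundedPoly (seq j))) (k₀ + j) := by
      intro j
      induction j with
      | zero => exact h₀
      | succ j ih => exact hnext' (k₀ + j) (seq j) ih
    exact ⟨seq, rfl, hv, fun j => hnext (k₀ + j) (seq j) (hv j)⟩
  obtain ⟨t, ht⟩ := exists_limit_pi (maximalIdeal R) (fun k => seq (k - k₀)) (by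
    intro k e
    rcases lt_or_ge k k₀ with hk | hk
    · rw [Nat.sub_eq_zero_of_le hk, Nat.sub_eq_zero_of_le hk.le, sub_self]
      exact zero_mem _
    · have := hseq (k - k₀) e
      have hk' : maximalIdeal R ^ (k₀ + (k - k₀)) = maximalIdeal R ^ k := by
        rw [Nat.add_sub_cancel' hk]
      rw [hk'] at this
      rwa [Nat.sub_add_comm hk])
  refine ⟨t, fun e => ?_, ?_⟩
  · have := ht k₀ e
    rwa [Nat.sub_self, hseq₀] at this
  · rw [← sub_eq_zero, ← neg_sub, neg_eq_zero]
    refine eq_zero_of_forall_vanishesAt fun k => ?_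
    have h1 := (hseqv k).of_le (Nat.le_add_left k k₀)
    have h2 : ∀ e, (seq k - t) e ∈ maximalIdeal R ^ k := fun e => by
      have := ht (k₀ + k) e
      rw [Nat.add_sub_cancel_left] at this
      rw [Pi.sub_apply, ← neg_sub, neg_mem_iff]
      exact Ideal.pow_le_pow_right (Nat.le_add_left k k₀) this
    have := h1.add (S.vanishesAt_evalPoly (S.boundedPoly_mem h2))
    have hsub : S.evalPoly (S.boundedPoly (seq k - t)) =
        S.evalPoly (S.boundedPoly (seq k)) - S.evalPoly (S.boundedPoly t) := by
      rw [LinearMap.map_sub, _root_.map_sub]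
    rwa [hsub, sub_add_sub_cancel] at this

theorem finite_chernRing (S : CoordinateSystem F G ι) [IsPrecomplete (maximalIdeal R) R] :
    Module.Finite R (chernRing F G) := by
  refine Module.Finite.of_surjective (S.evalPoly.toLinearMap ∘ₗ S.boundedPoly) fun s => ?_
  -- At level `0` there is nothing to approximate: an algebra killed by `𝔪 ^ 0` is zero.
  obtain ⟨t, -, ht⟩ := S.exists_evalPoly_boundedPoly_eq s 0 0 fun A hA f => by
    have h1 : algebraMap R A.1 1 = 0 := hA (by rw [pow_zero, Ideal.one_eq_top]; trivial)
    rw [_root_.map_one] at h1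
    rw [← mul_one ((s - S.evalPoly (S.boundedPoly 0)).1 A f), h1, mul_zero]
  exact ⟨t, ht⟩

/-- A homomorphism `C(E, G) → A` with `𝔪 ^ k A = 0` kills the natural transformations vanishing to
level `k`, since these have coefficients in `𝔪 ^ k`; so it factors through the representing algebra
of level `k`. -/
theorem bijective_evalPoint (S : CoordinateSystem F G ι) [IsPrecomplete (maximalIdeal R) R]
    (A : DiscreteAlg R) :
    Function.Bijective (evalPoint F G A) := by
  constructor
  · intro f g hfg
    apply S.coord_injective
    funext i
    have := DFunLike.congr_fun hfg (S.evalPoly (X i))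
    change (S.evalPoly (X i)).1 A f = (S.evalPoly (X i)).1 A g at this
    rwa [evalPoly_apply, evalPoly_apply, aeval_X, aeval_X] at this
  · intro g
    obtain ⟨k, hk⟩ := A.2
    have hzero : ∀ s, VanishesAt s k → g s = 0 := by
      intro s hs
      obtain ⟨t, ht, rfl⟩ := S.exists_evalPoly_boundedPoly_eq s k 0 (by
        rwa [_root_.map_zero, _root_.map_zero, sub_zero])
      rw [boundedPoly_apply, _root_.map_sum, _root_.map_sum]
      refine Finset.sum_eq_zero fun e _ => ?_
      have h0 : algebraMap R A.1 (t e) = 0 := hk (by simpa using ht e)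
      rw [_root_.map_smul, _root_.map_smul, Algebra.smul_def, h0, zero_mul]
    let φ : S.LevelRing k →ₐ[R] A.1 := Ideal.Quotient.liftₐ (S.levelIdeal k)
      (g.comp S.evalPoly) fun p hp => hzero _ (S.vanishesAt_evalPoly hp)
    refine ⟨(S.univPoint k).map φ, AlgHom.ext fun s => ?_⟩
    let Q : DiscreteAlg R := ⟨CommAlgCat.of R (S.LevelRing k), k, S.pow_le_ker_levelRing k⟩
    obtain ⟨p, hp⟩ := S.exists_vanishesAt_sub s k
    have h1 : s.1 Q (S.univPoint k) = Ideal.Quotient.mk (S.levelIdeal k) p := by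
      have h : s.1 Q (S.univPoint k) - (S.evalPoly p).1 Q (S.univPoint k) = 0 :=
        hp Q (S.pow_le_ker_levelRing k) (S.univPoint k)
      rw [sub_eq_zero.1 h, evalPoly_apply]
      have hc : S.coord _ (S.univPoint k) =
        fun i => Ideal.Quotient.mkₐ R (S.levelIdeal k) (X i) := S.coord_univPoint k
      have ha : aeval (fun i => Ideal.Quotient.mkₐ R (S.levelIdeal k) (X i)) =
          Ideal.Quotient.mkₐ R (S.levelIdeal k) :=
        MvPolynomial.algHom_ext fun i => by rw [aeval_X]
      exact (congrArg (fun y => aeval y p) hc).trans (DFunLike.congr_fun ha p)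
    have h2 : s.1 A ((S.univPoint k).map φ) = φ (s.1 Q (S.univPoint k)) :=
      s.2 Q A φ (S.univPoint k)
    show s.1 A ((S.univPoint k).map φ) = g s
    rw [h2, h1]
    have h3 : φ (Ideal.Quotient.mk (S.levelIdeal k) p) = g (S.evalPoly p) :=
      Ideal.Quotient.liftₐ_apply _ _ _ _
    have h4 := hzero _ hp
    rw [_root_.map_sub, sub_eq_zero] at h4
    rw [h3, h4]

end CoordinateSystem

end Representability

/-! ### The coordinates given by the coefficients of divisors -/

section ChernCoordinates

theorem IsDivisorOfDegree.pow {A : Type u} [CommRing A] {d : ℕ} {f : A[X]}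
    (hf : IsDivisorOfDegree d f) (m : ℕ) : IsDivisorOfDegree (m * d) (f ^ m) := by
  induction m with
  | zero => simpa using isDivisorOfDegree_one
  | succ m ih =>
    rw [pow_succ, add_mul, one_mul]
    exact ih.mul hf

theorem IsDivisorOfDegree.prod {A : Type u} [CommRing A] {ι : Type*} (s : Finset ι) {d : ι → ℕ}
    {f : ι → A[X]} (hf : ∀ i ∈ s, IsDivisorOfDegree (d i) (f i)) :
    IsDivisorOfDegree (∑ i ∈ s, d i) (∏ i ∈ s, f i) := by
  classical
  induction s using Finset.induction_on with
  | empty => simpa using isDivisorOfDegree_one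
  | insert i s hi ih =>
    rw [Finset.sum_insert hi, Finset.prod_insert hi]
    exact (hf i (Finset.mem_insert_self i s)).mul
      (ih fun j hj => hf j (Finset.mem_insert_of_mem hj))

/-- The monic polynomial of degree `d` with given lower coefficients. -/
def monicPoly {A : Type u} [CommRing A] {d : ℕ} (y : Fin d → A) : A[X] :=
  Polynomial.X ^ d + ∑ j, Polynomial.C (y j) * Polynomial.X ^ (j : ℕ)

theorem coeff_monicPoly_of_lt {A : Type u} [CommRing A] {d : ℕ} (y : Fin d → A) (j : Fin d) :
    (monicPoly y).coeff j = y j := by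
  rw [monicPoly, Polynomial.coeff_add, Polynomial.coeff_X_pow, if_neg j.2.ne, zero_add,
    Polynomial.finsetSum_coeff, Finset.sum_eq_single j]
  · simp
  · intro k _ hk
    rw [Polynomial.coeff_C_mul, Polynomial.coeff_X_pow, if_neg, mul_zero]
    exact fun h => hk (Fin.ext h.symm)
  · simp

theorem coeff_monicPoly_of_le {A : Type u} [CommRing A] {d : ℕ} (y : Fin d → A) {k : ℕ}
    (hk : d ≤ k) : (monicPoly y).coeff k = if k = d then 1 else 0 := by
  rw [monicPoly, Polynomial.coeff_add, Polynomial.coeff_X_pow, Polynomial.finsetSum_coeff,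
    Finset.sum_eq_zero, add_zero]
  intro j _
  rw [Polynomial.coeff_C_mul, Polynomial.coeff_X_pow, if_neg, mul_zero]
  have := j.2
  omega

theorem isDivisorOfDegree_monicPoly {A : Type u} [CommRing A] {d : ℕ} {y : Fin d → A}
    (hy : ∀ j, IsNilpotent (y j)) : IsDivisorOfDegree d (monicPoly y) where
  coeff_eq_one := by rw [coeff_monicPoly_of_le y le_rfl, if_pos rfl]
  coeff_eq_zero k hk := by rw [coeff_monicPoly_of_le y hk.le, if_neg hk.ne']
  isNilpotent_coeff k hk := by
    rw [coeff_monicPoly_of_lt y ⟨k, hk⟩]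
    exact hy _

theorem IsDivisorOfDegree.eq_of_coeff_eq {A : Type u} [CommRing A] {d : ℕ} {f g : A[X]}
    (hf : IsDivisorOfDegree d f) (hg : IsDivisorOfDegree d g)
    (h : ∀ j : Fin d, f.coeff j = g.coeff j) : f = g := by
  ext k
  rcases lt_trichotomy k d with hk | rfl | hk
  · exact h ⟨k, hk⟩
  · rw [hf.1, hg.1]
  · rw [hf.2 k hk, hg.2 k hk]

/-- The lower coefficients of the divisors of a finite family of generators of `R⁺(G)` form a
system of coordinates on `X_Ch(G)`. -/
theorem exists_coordinateSystem {R : Type u} [CommRing R] [IsLocalRing R] {p n : ℕ} (hp : p.Prime)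
    (hlocal : ∀ q : ℕ, q.Prime → q ≠ p → IsUnit (q : R)) (F : FormalGroup R) [F.IsComm]
    (hF : ReductionHasHeight F p n) (G : Type v) [Group G] [Finite G] :
    ∃ (r : ℕ) (d : Fin r → ℕ), Nonempty (CoordinateSystem F G (Σ i : Fin r, Fin (d i))) := by
  obtain ⟨r, s, c, hc⟩ := exists_repPlus_generators.{u} G
  choose M hM using fun i => exists_coeff_pow_eq_zero (F := F) hp hlocal hF (s i)
  refine ⟨r, fun i => Module.finrank ℂ (s i), ⟨?_⟩⟩
  refine
    { coord := fun A _ _ f ij => (f.toFun (RepPlus.mk (s ij.1))).eqn.coeff ij.2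
      coord_map := fun A B _ _ _ _ φ f ij => Polynomial.coeff_map _ _
      coord_injective := ?_
      bound := ∑ i, M i
      coord_pow_bound := ?_
      exists_point := ?_ }
  · intro A _ _ f g hfg
    have hgen : ∀ i, f.toFun (RepPlus.mk (s i)) = g.toFun (RepPlus.mk (s i)) := fun i =>
      DivPlus.eqn_injective ((f.isDivisorOfDegree (s i)).eq_of_coeff_eq (g.isDivisorOfDegree (s i))
        fun j => congrFun hfg ⟨i, j⟩)
    apply XCh.ext
    funext V
    rw [hc _ f.toFun f.map_zero f.map_add, hc _ g.toFun g.map_zero g.map_add]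
    exact Finset.sum_congr rfl fun i _ => by rw [hgen]
  · intro A _ _ hA f ij
    exact pow_eq_zero_of_le (Finset.single_le_sum (f := M) (fun _ _ => Nat.zero_le _)
      (Finset.mem_univ ij.1)) (hM ij.1 A hA f ij.2 ij.2.2)
  · intro A _ _ y hy hinj
    have hD : ∀ i, IsDivisorOfDegree _ (monicPoly fun j => y ⟨i, j⟩) := fun i =>
      isDivisorOfDegree_monicPoly fun j => hy ⟨i, j⟩
    -- The point is defined on all of `R⁺(G)` by additivity from its values `D i` on the generators.
    -- That this does not depend on choices is visible over the jointly injective family.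
    let D : Fin r → DivPlus A := fun i => DivPlus.ofEqn _ (hD i).isDivisor
    let f : RepPlus G → DivPlus A := fun V => ∑ i, c V i • D i
    have hgen : ∀ (B : Type u) [CommRing B] [Algebra R B] (φ : A →ₐ[R] B) (g : XCh F B G),
        (∀ ij : Σ i : Fin r, Fin (Module.finrank ℂ (s i)),
          φ (y ij) = (g.toFun (RepPlus.mk (s ij.1))).eqn.coeff ij.2) →
        ∀ i, DivPlus.map φ.toRingHom (D i) = g.toFun (RepPlus.mk (s i)) := by
      intro B _ _ φ g hg i
      apply DivPlus.eqn_injective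
      refine ((hD i).map φ.toRingHom).eq_of_coeff_eq (g.isDivisorOfDegree (s i)) fun j => ?_
      rw [Polynomial.coeff_map, coeff_monicPoly_of_lt, ← hg ⟨i, j⟩]
      rfl
    have hall : ∀ (B : Type u) [CommRing B] [Algebra R B] (φ : A →ₐ[R] B) (g : XCh F B G),
        (∀ ij : Σ i : Fin r, Fin (Module.finrank ℂ (s i)),
          φ (y ij) = (g.toFun (RepPlus.mk (s ij.1))).eqn.coeff ij.2) →
        ∀ V, DivPlus.map φ.toRingHom (f V) = g.toFun V := by
      intro B _ _ φ g hg V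
      rw [hc _ g.toFun g.map_zero g.map_add, map_sum]
      exact Finset.sum_congr rfl fun i _ => by rw [map_nsmul, hgen B φ g hg]
    obtain ⟨h, hh⟩ := exists_xCh_of_jointly_injective f (fun V => by
      refine ⟨∑ i, c V i * Module.finrank ℂ (s i), ?_⟩
      simp only [f, DivPlus.eqn_sum, DivPlus.eqn_nsmul]
      exact IsDivisorOfDegree.prod _ fun i _ => (hD i).pow (c V i))
      fun x hx => hinj x fun B _ _ φ g hg => hx B φ g (hall B φ g hg)
    refine ⟨h, funext fun ij => ?_⟩
    rw [← sub_eq_zero]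
    refine hinj _ fun B _ _ φ g hg => ?_
    rw [map_sub, sub_eq_zero, hg ij, hh, ← hall B φ g hg]
    exact (Polynomial.coeff_map _ _).symm

end ChernCoordinates

end ChernApprox

end

/-- `X_Ch(G)` is finite over `X = Spf(E₀)`: its coordinate ring `C(E, G)` is a finitely generated
`E₀`-module, and `X_Ch(G)` is the formal scheme `A ↦ Hom(C(E, G), A)` defined by this ring. -/
theorem mainTheorem4 {E₀ : Type u} [CommRing E₀] [IsLocalRing E₀] [IsNoetherianRing E₀]
    [IsAdicComplete (IsLocalRing.maximalIdeal E₀) E₀]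
    (p n : ℕ) (hp : p.Prime)
    (hlocal : ∀ q : ℕ, q.Prime → q ≠ p → IsUnit (q : E₀))
    (F : FormalGroup E₀) [F.IsComm] (hF : ChernApprox.ReductionHasHeight F p n)
    (G : Type v) [Group G] [Finite G] :
    Module.Finite E₀ (ChernApprox.chernRing F G) ∧
      ∀ A : ChernApprox.DiscreteAlg E₀, Function.Bijective (ChernApprox.evalPoint F G A) := by
  obtain ⟨r, d, ⟨S⟩⟩ := ChernApprox.exists_coordinateSystem hp hlocal F hF G
  exact ⟨S.finite_chernRing, S.bijective_evalPoint⟩
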